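/- Let $p,q,r,s$ be real numbers and let $D_n$ be the real symmetric $n\times n$ matrix with $(D_n)_{1,1}=(D_n)_{n,n}=r$, $(D_n)_{i,i}=p$ for $1<i<n$, $(D_n)_{i,j}=q$ if $|i-j|=1$, $(D_n)_{i,j}=s$ if $|i-j|=2$, and $(D_n)_{i,j}=0$ if $|i-j|>2$. All square roots below are principal complex square roots. Put $$f(z)=\begin{cases}(r-s)z^4+(ps-q^2)(z^3-sz^2)+s^3(s-p)z+s^5,& q\ne0,\ s\ne0,\\ rz^3-ps^2z+s^4,& q=0,\ s\neq 0,\\ rz-q^2,& s=0,\end{cases}$$ and write $f(z)=\sum_i f_i z^i$. For a number $z$, an integer $N\ge 1$ and a coefficient $\kappa=\kappa(m)$ that may depend on an index $m$, put $$[\kappa f](z;N)=\sum_{i} f_i\,\kappa(N+i)\,z^{N+i},$$ so that $[\kappa f](z;N)=\kappa\, f(z)\, z^{N}$ whenever $\kappa$ does not depend on $m$. Then $$\det D_n=\begin{cases}\sum_{j=1}^5[\kappa_jf](\mu_j;n-5),& q\ne0,\ s\ne0,\ n\ge6,\\ \sum_{j=1}^4[\kappa_jf](\nu_j;n-4),&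 q=0,\ s\ne0,\ n\ge5,\\ \sum_{j=1}^2[\kappa_jf](\xi_j;n-2),& q\neq0,\ s=0,\ n\ge3,\\ r^2p^{n-2},& q=s=0,\ n\ge3,\end{cases}$$ where the roots and the coefficients are the following. In particular, in the subcases (1a), (2a), (3a) below, in which the $\kappa_j$ are constant, $\det D_n$ equals, respectively, $\sum_{j=1}^5\kappa_jf(\mu_j)\mu_j^{n-5}$, $\sum_{j=1}^4\kappa_jf(\nu_j)\nu_j^{n-4}$, $\sum_{j=1}^2\kappa_jf(\xi_j)\xi_j^{n-2}$. **(1) $q\ne0$, $s\ne0$.** With $\alpha=\sqrt{(p+2s)^2-4q^2}$, $\beta_1=\sqrt{2(p-2s)(p+2s-\alpha)-4q^2}$, $\beta_2=\sqrt{2(p-2s)(p+2s+\alpha)-4q^2}$, $$\mu_{1}=\tfrac{p-2s-\alpha-\beta_1}{4},\quad \mu_2=\tfrac{p-2s-\alpha+\beta_1}{4},\quad \mu_{3}=\tfrac{p-2s+\alpha-\beta_2}{4},\quad \mu_4=\tfrac{p-2s+\alpha+\beta_2}{4},\quad \mu_5=s.$$ (1a) If $q^2\notin\{4s(p-2s),(p+2s)^2/4\}$,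 then $\kappa_1=K(-\alpha,\beta_2,-\beta_1)$, $\kappa_2=K(-\alpha,\beta_2,\beta_1)$, $\kappa_3=K(\alpha,\beta_1,-\beta_2)$, $\kappa_4=K(\alpha,\beta_1,\beta_2)$, $\kappa_5=\frac{2s(r+s-p)}{q^2-4s(p-2s)}$, where $K(x,y,z)=\dfrac{64\,P(x,z)}{z(p-2s+x+z)(p-6s+x+z)((2x+z)^2-y^2)}$ and $$\begin{aligned}P(x,z)={}&2s^4(2s+3p+x+z)+ps^2\big(4q^2-2s(p-x)-(p+x)(2p+z)\big)\\&-2sq^2\big(4q^2-2p^2-(p-2s)(2x+z)-xz\big)\\&+r\big(4q^4-q^2(p+x)(2p+z)+2sq^2(p-2s+3x+2z)-2s^2p(p+x+z)-2s^3(p-2s-x+z)\big)\\&+(q^2-pr)\big(2s^2(2s+3p+x)+2q^2(3p-4s+x+z)-(s(p-x)+p(p+x))(2p+z)\big).\end{aligned}$$ For (1b) and (1c), put $\gamma=\sqrt{(p-6s)(p-2s)}$, $K_1=\frac{p^2-p(r+8s)+2s(2r+11s)}{(p-6s)^2}$, $K_2(j)=\frac{p-r-js}{p-6s}$ and $K_3(z)=\frac{2s^2(p-2s)^2(p-4s+z)\left((r-p)(p-4s+z)+2s^2\right)}{z\left(4s(3s-z)+p(p-8s+z)\right)^3}$.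 (1b) If $q^2=4s(p-2s)$ and $p>6s$, then $\kappa_1=K_1$, $\kappa_2(m)=2mK_2(2)$, $\kappa_3=K_3(\gamma)$, $\kappa_4=K_3(-\gamma)$, $\kappa_5(m)=m^2K_2(1)$. (1c) If $q^2=4s(p-2s)$ and $p<6s$, then $\kappa_1=K_3(\gamma)$, $\kappa_2=K_3(-\gamma)$, $\kappa_3=K_1$, $\kappa_4(m)=2mK_2(2)$, $\kappa_5(m)=m^2K_2(1)$. (1d) If $q^2=(p+2s)^2/4$ and $p\ne6s$, put $\delta=\sqrt{(p-6s)(p+2s)}$; then $\kappa_1=K_4(\delta)$, $\kappa_2=K_4(-\delta)$, $\kappa_3(m)=mK_5(\delta)$, $\kappa_4(m)=mK_5(-\delta)$, $\kappa_5=\frac{8s(r+s-p)}{(p-6s)^2}$, where $K_4(z)=\dfrac{8\,Q_4(z)}{z(p-6s)(p-2s-z)^2(p-6s-z)^2}$, $K_5(z)=\dfrac{4\,Q_5(z)}{z^2(p-6s-z)(p-2s-z)^2}$ and $$\begin{aligned}Q_4(z)={}&p^5(12s-p+z)-2p^4s(24s-4r+5z)-4p^3s\big(2r(10s+z)-s(16s+9z)\big)\\&+8p^2s^2\big(4r(5s+2z)+s(20s-7z)\big)+16ps^3\big(2r(8s-3z)-5s(8s+z)\big)\\&-32s^4\big(2r(6s+z)+s(6s-7z)\big),\\Q_5(z)={}&p^4(2r+4s-p+z)-2p^3\big(r(6s+z)-s(6s-z)\big)-8p^2s\big(r(s-z)+s(s+z)\big)\\&+8ps^2\big(r(8s+z)-s(6s+z)\big)-16s^3\big(4s^2-r(2s-z)\big).\end{aligned}$$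 (1e) If $q^2\in\{4s(p-2s),(p+2s)^2/4\}$ and $p=6s$, then $\kappa_1=1$, $\kappa_2(m)=m\frac{r+8s}{6s}$, $\kappa_3(m)=m^2\frac{5r-7s}{12s}$, $\kappa_4(m)=m^3\frac{r-4s}{3s}$, $\kappa_5(m)=m^4\frac{r-5s}{12s}$. **(2) $q=0$, $s\ne0$.** Put $\omega=\sqrt{p^2-4s^2}$, $\nu_1=-s$, $\nu_2=s$, $\nu_3=\frac{p-\omega}{2}$, $\nu_4=\frac{p+\omega}{2}$. (2a) If $p^2\ne4s^2$, then $\kappa_1=K_6(1)$, $\kappa_2=K_6(-1)$, $\kappa_3=K_7(1)$, $\kappa_4=K_7(-1)$, where $K_6(j)=\frac{p-r+js}{2(p+2js)}$ and $K_7(j)=\frac{p^3r-p^2s^2-3prs^2+2s^4+j(ps^2+rs^2-p^2r)\omega}{(p^2-4s^2)(p^2-2s^2-jp\omega)}$. (2b) If $p=2s$, then $\kappa_1=\frac{3s-r}{8s}$, $\kappa_2=\frac{r+5s}{8s}$, $\kappa_3(m)=m\frac{r}{2s}$, $\kappa_4(m)=m^2\frac{r-s}{4s}$. (2c) If $p=-2s$,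 then $\kappa_1=\frac{5s-r}{8s}$, $\kappa_2=\frac{r+3s}{8s}$, $\kappa_3(m)=-m\frac{r}{2s}$, $\kappa_4(m)=-m^2\frac{r+s}{4s}$. **(3) $q\ne0$, $s=0$.** Put $\theta=\sqrt{p^2-4q^2}$, $\xi_1=\frac{p-\theta}{2}$, $\xi_2=\frac{p+\theta}{2}$. (3a) If $p^2\ne4q^2$, then $\kappa_1=\frac{p-2r+\theta}{2\theta}$, $\kappa_2=\frac{2r-p+\theta}{2\theta}$. (3b) If $p^2=4q^2$, then $\kappa_1=1$, $\kappa_2(m)=m\frac{2r-p}{p}$. -/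

import Mathlib

namespace Penta

open Polynomial

/-- The symmetric pentadiagonal matrix of order `n` with diagonal `p`, first off-diagonals `q`,
second off-diagonals `s`, whose upper left and lower right corner entries are replaced by `r`. -/
def D (p q r s : ℝ) (n : ℕ) : Matrix (Fin n) (Fin n) ℝ :=
  Matrix.of fun i j =>
    if i = j then (if (i : ℕ) = 0 ∨ (i : ℕ) + 1 = n then r else p)
    else if (i : ℕ) + 1 = j ∨ (j : ℕ) + 1 = i then q
    else if (i : ℕ) + 2 = j ∨ (j : ℕ) + 2 = i then s
    else 0

/-- The polynomial `f`. -/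
noncomputable def f (p q r s : ℝ) : ℂ[X] :=
  if q ≠ 0 ∧ s ≠ 0 then
    C ((r : ℂ) - s) * X ^ 4 + C ((p : ℂ) * s - q ^ 2) * (X ^ 3 - C (s : ℂ) * X ^ 2)
      + C ((s : ℂ) ^ 3 * (s - p)) * X + C ((s : ℂ) ^ 5)
  else if q = 0 ∧ s ≠ 0 then
    C (r : ℂ) * X ^ 3 - C ((p : ℂ) * s ^ 2) * X + C ((s : ℂ) ^ 4)
  else
    C (r : ℂ) * X - C ((q : ℂ) ^ 2)

/-- For `f` of degree less than `d` and a coefficient `κ m` that may depend on the index `m`,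
the sum of `f_i κ (N + i) z ^ (N + i)` over the monomials `f_i z ^ i` of `f`.
If `κ` is constant this is `κ f(z) z ^ N`. -/
noncomputable def term (d : ℕ) (f : ℂ[X]) (κ : ℕ → ℂ) (z : ℂ) (N : ℕ) : ℂ :=
  ∑ i ∈ Finset.range d, f.coeff i * κ (N + i) * z ^ (N + i)

/-! Case `q ≠ 0`, `s ≠ 0`. -/

noncomputable def α (p q s : ℝ) : ℂ := Complex.sqrt (((p : ℂ) + 2 * s) ^ 2 - 4 * q ^ 2)

noncomputable def β₁ (p q s : ℝ) : ℂ :=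
  Complex.sqrt (2 * ((p : ℂ) - 2 * s) * (p + 2 * s - α p q s) - 4 * q ^ 2)

noncomputable def β₂ (p q s : ℝ) : ℂ :=
  Complex.sqrt (2 * ((p : ℂ) - 2 * s) * (p + 2 * s + α p q s) - 4 * q ^ 2)

/-- The roots `μ₁, …, μ₅`, indexed from `0`. -/
noncomputable def μ (p q s : ℝ) : Fin 5 → ℂ :=
  ![((p : ℂ) - 2 * s - α p q s - β₁ p q s) / 4,
    ((p : ℂ) - 2 * s - α p q s + β₁ p q s) / 4,
    ((p : ℂ) - 2 * s + α p q s - β₂ p q s) / 4,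
    ((p : ℂ) - 2 * s + α p q s + β₂ p q s) / 4,
    (s : ℂ)]

noncomputable def K (p q r s x y z : ℂ) : ℂ :=
  64 * (2 * s ^ 4 * (2 * s + 3 * p + x + z)
      + p * s ^ 2 * (4 * q ^ 2 - 2 * s * (p - x) - (p + x) * (2 * p + z))
      - 2 * s * q ^ 2 * (4 * q ^ 2 - 2 * p ^ 2 - (p - 2 * s) * (2 * x + z) - x * z)
      + r * (4 * q ^ 4 - q ^ 2 * (p + x) * (2 * p + z)
          + 2 * s * q ^ 2 * (p - 2 * s + 3 * x + 2 * z)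
          - 2 * s ^ 2 * p * (p + x + z) - 2 * s ^ 3 * (p - 2 * s - x + z))
      + (q ^ 2 - p * r) * (2 * s ^ 2 * (2 * s + 3 * p + x)
          + 2 * q ^ 2 * (3 * p - 4 * s + x + z)
          - (s * (p - x) + p * (p + x)) * (2 * p + z)))
    / (z * (p - 2 * s + x + z) * (p - 6 * s + x + z) * ((2 * x + z) ^ 2 - y ^ 2))

noncomputable def K₁ (p r s : ℂ) : ℂ :=
  (p ^ 2 - p * (r + 8 * s) + 2 * s * (2 * r + 11 * s)) / (p - 6 * s) ^ 2

noncomputable def K₂ (p r s j : ℂ) : ℂ := (p - r - j * s) / (p - 6 * s)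

noncomputable def K₃ (p r s z : ℂ) : ℂ :=
  2 * s ^ 2 * (p - 2 * s) ^ 2 * (p - 4 * s + z) * ((r - p) * (p - 4 * s + z) + 2 * s ^ 2)
    / (z * (4 * s * (3 * s - z) + p * (p - 8 * s + z)) ^ 3)

noncomputable def K₄ (p r s z : ℂ) : ℂ :=
  8 * (p ^ 5 * (12 * s - p + z) - 2 * p ^ 4 * s * (24 * s - 4 * r + 5 * z)
      - 4 * p ^ 3 * s * (2 * r * (10 * s + z) - s * (16 * s + 9 * z))
      + 8 * p ^ 2 * s ^ 2 * (4 * r * (5 * s + 2 * z) + s * (20 * s - 7 * z))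
      + 16 * p * s ^ 3 * (2 * r * (8 * s - 3 * z) - 5 * s * (8 * s + z))
      - 32 * s ^ 4 * (2 * r * (6 * s + z) + s * (6 * s - 7 * z)))
    / (z * (p - 6 * s) * (p - 2 * s - z) ^ 2 * (p - 6 * s - z) ^ 2)

noncomputable def K₅ (p r s z : ℂ) : ℂ :=
  4 * (p ^ 4 * (2 * r + 4 * s - p + z)
      - 2 * p ^ 3 * (r * (6 * s + z) - s * (6 * s - z))
      - 8 * p ^ 2 * s * (r * (s - z) + s * (s + z))
      + 8 * p * s ^ 2 * (r * (8 * s + z) - s * (6 * s + z))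
      - 16 * s ^ 3 * (4 * s ^ 2 - r * (2 * s - z)))
    / (z ^ 2 * (p - 6 * s - z) * (p - 2 * s - z) ^ 2)

noncomputable def γ (p s : ℝ) : ℂ := Complex.sqrt (((p : ℂ) - 6 * s) * (p - 2 * s))

noncomputable def δ (p s : ℝ) : ℂ := Complex.sqrt (((p : ℂ) - 6 * s) * (p + 2 * s))

/-- The coefficients `κ₁(m), …, κ₅(m)` for `q ≠ 0`, `s ≠ 0`. -/
noncomputable def κ (p q r s : ℝ) (m : ℕ) : Fin 5 → ℂ :=
  if q ^ 2 ≠ 4 * s * (p - 2 * s) ∧ q ^ 2 ≠ (p + 2 * s) ^ 2 / 4 then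
    ![K p q r s (-α p q s) (β₂ p q s) (-β₁ p q s),
      K p q r s (-α p q s) (β₂ p q s) (β₁ p q s),
      K p q r s (α p q s) (β₁ p q s) (-β₂ p q s),
      K p q r s (α p q s) (β₁ p q s) (β₂ p q s),
      2 * (s : ℂ) * (r + s - p) / ((q : ℂ) ^ 2 - 4 * s * (p - 2 * s))]
  else if q ^ 2 = 4 * s * (p - 2 * s) ∧ p > 6 * s then
    ![K₁ p r s, 2 * (m : ℂ) * K₂ p r s 2, K₃ p r s (γ p s), K₃ p r s (-γ p s),
      (m : ℂ) ^ 2 * K₂ p r s 1]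
  else if q ^ 2 = 4 * s * (p - 2 * s) ∧ p < 6 * s then
    ![K₃ p r s (γ p s), K₃ p r s (-γ p s), K₁ p r s, 2 * (m : ℂ) * K₂ p r s 2,
      (m : ℂ) ^ 2 * K₂ p r s 1]
  else if q ^ 2 = (p + 2 * s) ^ 2 / 4 ∧ p ≠ 6 * s then
    ![K₄ p r s (δ p s), K₄ p r s (-δ p s), (m : ℂ) * K₅ p r s (δ p s),
      (m : ℂ) * K₅ p r s (-δ p s), 8 * (s : ℂ) * (r + s - p) / ((p : ℂ) - 6 * s) ^ 2]
  else
    ![1, (m : ℂ) * (((r : ℂ) + 8 * s) / (6 * s)),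
      (m : ℂ) ^ 2 * ((5 * (r : ℂ) - 7 * s) / (12 * s)),
      (m : ℂ) ^ 3 * (((r : ℂ) - 4 * s) / (3 * s)),
      (m : ℂ) ^ 4 * (((r : ℂ) - 5 * s) / (12 * s))]

/-! Case `q = 0`, `s ≠ 0`. -/

/-- The roots `ν₁, …, ν₄`, indexed from `0`. -/
noncomputable def ν (p s : ℝ) : Fin 4 → ℂ :=
  ![-(s : ℂ), (s : ℂ),
    ((p : ℂ) - Complex.sqrt ((p : ℂ) ^ 2 - 4 * s ^ 2)) / 2,
    ((p : ℂ) + Complex.sqrt ((p : ℂ) ^ 2 - 4 * s ^ 2)) / 2]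

noncomputable def K₆ (p r s j : ℂ) : ℂ := (p - r + j * s) / (2 * (p + 2 * j * s))

noncomputable def K₇ (p r s j : ℂ) : ℂ :=
  (p ^ 3 * r - p ^ 2 * s ^ 2 - 3 * p * r * s ^ 2 + 2 * s ^ 4
      + j * (p * s ^ 2 + r * s ^ 2 - p ^ 2 * r) * Complex.sqrt (p ^ 2 - 4 * s ^ 2))
    / ((p ^ 2 - 4 * s ^ 2) * (p ^ 2 - 2 * s ^ 2 - j * p * Complex.sqrt (p ^ 2 - 4 * s ^ 2)))

/-- The coefficients `κ₁(m), …, κ₄(m)` for `q = 0`, `s ≠ 0`. -/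
noncomputable def κ' (p r s : ℝ) (m : ℕ) : Fin 4 → ℂ :=
  if p ^ 2 ≠ 4 * s ^ 2 then
    ![K₆ p r s 1, K₆ p r s (-1), K₇ p r s 1, K₇ p r s (-1)]
  else if p = 2 * s then
    ![(3 * (s : ℂ) - r) / (8 * s), ((r : ℂ) + 5 * s) / (8 * s),
      (m : ℂ) * ((r : ℂ) / (2 * s)), (m : ℂ) ^ 2 * (((r : ℂ) - s) / (4 * s))]
  else
    ![(5 * (s : ℂ) - r) / (8 * s), ((r : ℂ) + 3 * s) / (8 * s),
      -(m : ℂ) * ((r : ℂ) / (2 * s)), -(m : ℂ) ^ 2 * (((r : ℂ) + s) / (4 * s))]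

/-! Case `q ≠ 0`, `s = 0`. -/

/-- The roots `ξ₁, ξ₂`, indexed from `0`. -/
noncomputable def ξ (p q : ℝ) : Fin 2 → ℂ :=
  ![((p : ℂ) - Complex.sqrt ((p : ℂ) ^ 2 - 4 * q ^ 2)) / 2,
    ((p : ℂ) + Complex.sqrt ((p : ℂ) ^ 2 - 4 * q ^ 2)) / 2]

/-- The coefficients `κ₁(m), κ₂(m)` for `q ≠ 0`, `s = 0`. -/
noncomputable def κ'' (p q r : ℝ) (m : ℕ) : Fin 2 → ℂ :=
  if p ^ 2 ≠ 4 * q ^ 2 then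
    ![((p : ℂ) - 2 * r + Complex.sqrt ((p : ℂ) ^ 2 - 4 * q ^ 2))
        / (2 * Complex.sqrt ((p : ℂ) ^ 2 - 4 * q ^ 2)),
      (2 * (r : ℂ) - p + Complex.sqrt ((p : ℂ) ^ 2 - 4 * q ^ 2))
        / (2 * Complex.sqrt ((p : ℂ) ^ 2 - 4 * q ^ 2))]
  else
    ![1, (m : ℂ) * ((2 * (r : ℂ) - p) / p)]

end Penta

/-!
Let `u k` be the determinant of the matrix of order `k + 1` that is Toeplitz except for the entry
`r` in its lower right corner. Splitting off the upper left corner gives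
`det D_n = u (n - 1) + (r - p) u (n - 2)`, lemma `det_D`.

The sequence `u` obeys a linear recurrence. To see this, leave the upper left `2 × 2` block
`!![a, b; b, c]` of `D_n` free (`bordered`). Its determinant is a combination of
`1, a, b, c, ac - b²`, and eliminating the first column gives a matrix of the same kind of order
`n - 1`; the five coefficients are therefore transformed by a fixed linear map (`blockCoeff`,
`det_bordered`). The characteristic polynomial of this map is
`(z - s)(z² - A z + s²)(z² - B z + s²)` with `A + B = p - 2s` and `(A + 2s)(B + 2s) = q²`, whose
roots are `μ₁, …, μ₅`; for `q = 0` and for `s = 0` it can be replaced by factors of degree four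
and two with the roots `ν` and `ξ`. The polynomial `f` is this recurrence used to rewrite
`u (n - 1) + (r - p) u (n - 2)` in terms of earlier values (`det_D_eq_sum_f`), so everything reduces
to `u (m - 1) = ∑ j, κ_j(m) μ_j ^ m`.

The right hand side solves the same recurrence, so only its first values have to be compared with
those of `u` (`eq_of_recurrence`). If the five roots for `q ≠ 0`, `s ≠ 0` are distinct, the
generating function of `u` shows that `κ_j` must be `(μ_j + s) μ_j² (μ_j + r - p) / P'(μ_j)`,
where `P` is the characteristic polynomial; `K_eq` identifies this with `K`, and the first values follow from the Lagrange
interpolation identities `∑ j, μ_j ^ k / P'(μ_j) = 0` for `k < 4`, and `= 1` for `k = 4`. In the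
other cases all data become rational in suitable square roots (those of `p - 6s` and of `p - 2s` or
`p + 2s` if two or three of the five roots coincide, those of `ν₃` and `ν₄` if `q = 0`), and the
first values are checked directly. The principal branches matter only for
matching each `κ_j` with its root.
-/

namespace Penta

open Polynomial Matrix

/-! ### Determinants with a free leading block -/

/-- The matrix `D` with its leading `2 × 2` block replaced by `!![a, b; b, c]`. -/
def bordered (p q r s a b c : ℝ) (n : ℕ) : Matrix (Fin n) (Fin n) ℝ :=
  Matrix.of fun i j =>
    if (i : ℕ) = 0 ∧ (j : ℕ) = 0 then a
    else if (i : ℕ) + j = 1 then b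
    else if (i : ℕ) = 1 ∧ (j : ℕ) = 1 then c
    else D p q r s n i j

theorem D_eq_bordered (p q r s : ℝ) (n : ℕ) (hn : 3 ≤ n) :
    D p q r s n = bordered p q r s r q p n := by
  ext i j
  simp only [D, bordered, of_apply, Fin.ext_iff]
  split_ifs <;> first | rfl | omega

/-- The coefficients of `det (bordered … a b c (k + 3))` as a combination of
`1, a, b, c, a * c - b ^ 2`, in this order; see `det_bordered`. They start at order three, the
smallest one in which the lower right corner lies outside the leading block. -/
def blockCoeff (p q r s : ℝ) : ℕ → ℝ × ℝ × ℝ × ℝ × ℝ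
  | 0 => (0, -q ^ 2, 2 * q * s, -s ^ 2, r)
  | k + 1 =>
    let x := blockCoeff p q r s k
    (-s ^ 2 * x.2.2.2.1, x.1 + q * x.2.2.1 + p * x.2.2.2.1 - q ^ 2 * x.2.2.2.2,
      -s * x.2.2.1 + 2 * q * s * x.2.2.2.2, -s ^ 2 * x.2.2.2.2, x.2.1 + p * x.2.2.2.2)

/-- Clearing the first column with the pivot `a` changes only the next `2 × 2` block and so leaves a
matrix of the same shape, of order one less. -/
theorem det_bordered_succ (p q r s a b c : ℝ) (k : ℕ) (ha : a ≠ 0) :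
    (bordered p q r s a b c (k + 4)).det
      = a * (bordered p q r s (c - b ^ 2 / a) (q - b * s / a) (p - s ^ 2 / a) (k + 3)).det := by
  set A := bordered p q r s a b c (k + 4) with hA
  let w : Fin (k + 4) → ℝ := fun i => if i = 0 then 0 else A i 0 / a
  have h00 : A 0 0 = a := by simp [hA, bordered]
  let B : Matrix (Fin (k + 4)) (Fin (k + 4)) ℝ := of fun i j => A i j - w i * A 0 j
  have hB0 : ∀ j, B 0 j = A 0 j := fun j => by simp [B, w]
  have hBs : ∀ i : Fin (k + 3), B i.succ 0 = 0 := fun i => by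
    simp [B, w, h00, Fin.succ_ne_zero, ha]
  rw [det_eq_of_forall_row_eq_smul_add_const (B := B) w 0 (by simp [w])
    (fun i j => by rw [hB0]; simp [B]), det_succ_column_zero, Fin.sum_univ_succ]
  simp only [hBs, hB0, h00, Fin.val_zero, pow_zero, one_mul, mul_zero, zero_mul,
    Finset.sum_const_zero, add_zero]
  congr 2
  ext i j
  simp only [submatrix_apply, B, w, of_apply, Fin.zero_succAbove, hA,
    bordered, D, Fin.ext_iff, Fin.val_succ, Fin.val_zero]
  rcases i with ⟨i, hi⟩
  rcases j with ⟨j, hj⟩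
  simp only
  obtain rfl | rfl | ⟨i, rfl⟩ : i = 0 ∨ i = 1 ∨ ∃ i', i = i' + 2 := by
    rcases i with _ | _ | i <;> simp
  all_goals
    obtain rfl | rfl | ⟨j, rfl⟩ : j = 0 ∨ j = 1 ∨ ∃ j', j = j' + 2 := by
      rcases j with _ | _ | j <;> simp
  all_goals
    simp
  all_goals (try split_ifs) <;> first | omega | ring1

theorem continuous_det_bordered (p q r s b c : ℝ) (n : ℕ) :
    Continuous fun a => (bordered p q r s a b c n).det := by
  refine Continuous.matrix_det (continuous_matrix fun i j => ?_)
  simp only [bordered, of_apply]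
  split_ifs <;> fun_prop

theorem det_bordered (p q r s : ℝ) (k : ℕ) (a b c : ℝ) :
    (bordered p q r s a b c (k + 3)).det =
      (blockCoeff p q r s k).1 + (blockCoeff p q r s k).2.1 * a
        + (blockCoeff p q r s k).2.2.1 * b + (blockCoeff p q r s k).2.2.2.1 * c
        + (blockCoeff p q r s k).2.2.2.2 * (a * c - b ^ 2) := by
  induction k generalizing a b c with
  | zero =>
    rw [det_fin_three]
    simp [bordered, D, blockCoeff]
    ring
  | succ k ih =>
    -- Both sides are continuous in `a`, so the pivot `a` may be assumed nonzero.
    suffices h : Set.EqOn (fun a => (bordered p q r s a b c (k + 1 + 3)).det)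
        (fun a => (blockCoeff p q r s (k + 1)).1 + (blockCoeff p q r s (k + 1)).2.1 * a
          + (blockCoeff p q r s (k + 1)).2.2.1 * b + (blockCoeff p q r s (k + 1)).2.2.2.1 * c
          + (blockCoeff p q r s (k + 1)).2.2.2.2 * (a * c - b ^ 2)) {0}ᶜ from
      congrFun (Continuous.ext_on (dense_compl_singleton 0)
        (continuous_det_bordered p q r s b c _) (by fun_prop) h) a
    intro a ha
    have ha : a ≠ 0 := ha
    simp only
    rw [show k + 1 + 3 = k + 4 from rfl, det_bordered_succ _ _ _ _ _ _ _ _ ha, ih]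
    simp only [blockCoeff]
    field_simp
    ring

/-- The determinant of the matrix of order `k + 1` in which only the lower right corner of the
Toeplitz matrix is replaced by `r`: it is the coefficient of `a * c - b ^ 2` in
`det (bordered … a b c (k + 3))`. -/
def u (p q r s : ℝ) (k : ℕ) : ℝ := (blockCoeff p q r s k).2.2.2.2

theorem det_D (p q r s : ℝ) (k : ℕ) :
    (D p q r s (k + 3)).det = u p q r s (k + 2) + (r - p) * u p q r s (k + 1) := by
  rw [D_eq_bordered _ _ _ _ _ (by omega), det_bordered]
  simp only [u, blockCoeff]
  ring

/-- The recurrence with characteristic polynomial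
`(z - s)(z ^ 4 - (p - 2s) z ^ 3 + (q ^ 2 - 2ps + 2s ^ 2) z ^ 2 - s ^ 2 (p - 2s) z + s ^ 4)`. -/
theorem u_rec (p q r s : ℝ) (k : ℕ) :
    u p q r s (k + 5) = (p - s) * u p q r s (k + 4) - (q ^ 2 - p * s) * u p q r s (k + 3)
      + s * (q ^ 2 - p * s) * u p q r s (k + 2) - s ^ 3 * (p - s) * u p q r s (k + 1)
      + s ^ 5 * u p q r s k := by
  simp only [u, blockCoeff]
  ring

theorem u_rec_of_q_eq_zero (p r s : ℝ) (k : ℕ) :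
    u p 0 r s (k + 4) = p * u p 0 r s (k + 3) - p * s ^ 2 * u p 0 r s (k + 1)
      + s ^ 4 * u p 0 r s k := by
  simp only [u, blockCoeff]
  ring

theorem u_zero (p q r s : ℝ) : u p q r s 0 = r := rfl

theorem u_one (p q r s : ℝ) : u p q r s 1 = p * r - q ^ 2 := by
  simp only [u, blockCoeff]
  ring

theorem u_two (p q r s : ℝ) :
    u p q r s 2 = r * (p ^ 2 - q ^ 2) - p * q ^ 2 + 2 * q ^ 2 * s - p * s ^ 2 := by
  simp only [u, blockCoeff]
  ring

theorem u_rec_of_s_eq_zero (p q r : ℝ) (k : ℕ) :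
    u p q r 0 (k + 2) = p * u p q r 0 (k + 1) - q ^ 2 * u p q r 0 k := by
  rcases k with _ | _ | k <;> simp only [u, blockCoeff] <;> ring_nf

theorem u_three (p q r s : ℝ) :
    u p q r s 3 = r * (p ^ 3 - 2 * p * q ^ 2 + 2 * q ^ 2 * s - p * s ^ 2)
      + q ^ 4 - p ^ 2 * q ^ 2 + 2 * p * q ^ 2 * s - 2 * q ^ 2 * s ^ 2 - p ^ 2 * s ^ 2 + s ^ 4 := by
  simp only [u, blockCoeff]
  ring

theorem u_four (p q r s : ℝ) :
    u p q r s 4 = r * (p ^ 4 - 3 * p ^ 2 * q ^ 2 + 4 * p * q ^ 2 * s + q ^ 4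
        - 2 * q ^ 2 * s ^ 2 - 2 * p ^ 2 * s ^ 2 + s ^ 4)
      - p ^ 3 * q ^ 2 + 2 * p ^ 2 * q ^ 2 * s + 2 * p * q ^ 4 - 4 * q ^ 4 * s
      + 2 * q ^ 2 * s ^ 3 - p ^ 3 * s ^ 2 + p * s ^ 4 := by
  simp only [u, blockCoeff]
  ring

/-! ### Recurrences, Lagrange sums and the polynomial `f` -/

theorem eq_of_recurrence {d : ℕ} (c : Fin d → ℂ) {a b : ℕ → ℂ}
    (ha : ∀ k, a (k + d) = ∑ i, c i * a (k + i)) (hb : ∀ k, b (k + d) = ∑ i, c i * b (k + i))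
    (h : ∀ i < d, a i = b i) (k : ℕ) : a k = b k := by
  let E : LinearRecurrence ℂ := ⟨d, c⟩
  refine congrFun ((E.eq_iff_eqOn_range_order a b ha hb).2 fun i hi => h i ?_) k
  simpa [E] using hi

/-- The leading coefficient of the Lagrange interpolant of `X ^ k` at five distinct nodes. -/
theorem sum_pow_div_prod_sub (v : Fin 5 → ℂ) (hv : Function.Injective v) (k : ℕ) (hk : k < 5) :
    ∑ j, v j ^ k / ∏ i ∈ Finset.univ.erase j, (v j - v i) = if k = 4 then 1 else 0 := by
  have h := Lagrange.coeff_eq_sum (s := Finset.univ) (v := v) hv.injOn (P := (X ^ k : ℂ[X]))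
    (by rw [degree_X_pow]; simpa using hk)
  simp [coeff_X_pow] at h
  rw [← h]
  simp only [eq_comm]

theorem f_coeff (p q r s : ℝ) (hq : q ≠ 0) (hs : s ≠ 0) :
    (f p q r s).coeff 0 = s ^ 5 ∧ (f p q r s).coeff 1 = s ^ 3 * (s - p) ∧
      (f p q r s).coeff 2 = -(p * s - q ^ 2) * s ∧ (f p q r s).coeff 3 = p * s - q ^ 2 ∧
      (f p q r s).coeff 4 = r - s := by
  have hf : f p q r s = C ((r : ℂ) - s) * X ^ 4 + C ((p : ℂ) * s - q ^ 2) * X ^ 3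
      + C (-((p : ℂ) * s - q ^ 2) * s) * X ^ 2 + C ((s : ℂ) ^ 3 * (s - p)) * X
      + C ((s : ℂ) ^ 5) := by
    rw [f, if_pos ⟨hq, hs⟩, C_mul (a := -_), C_neg]
    ring
  generalize (s : ℂ) ^ 5 = a at *
  simp [hf, coeff_X, coeff_C, coeff_X_pow, -map_mul, -map_sub, -map_neg]

theorem f_coeff_of_q_eq_zero (p r s : ℝ) (hs : s ≠ 0) :
    (f p 0 r s).coeff 0 = s ^ 4 ∧ (f p 0 r s).coeff 1 = -(p * s ^ 2) ∧
      (f p 0 r s).coeff 2 = 0 ∧ (f p 0 r s).coeff 3 = r := by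
  rw [f, if_neg (by simp), if_pos ⟨rfl, hs⟩]
  generalize (s : ℂ) ^ 4 = a
  generalize (p : ℂ) * s ^ 2 = b
  simp [coeff_X, coeff_C, coeff_X_pow]

theorem f_coeff_of_s_eq_zero (p q r : ℝ) :
    (f p q r 0).coeff 0 = -q ^ 2 ∧ (f p q r 0).coeff 1 = r := by
  rw [f, if_neg (by simp), if_neg (by simp)]
  generalize (q : ℂ) ^ 2 = a
  simp [coeff_X, coeff_C]

/-- If `w (m - 1) = ∑ j, κ_j(m) z_j ^ m` for all `m ≥ 1`, then the sums `term` over the `z_j` add up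
to the combination of values of `w` with the coefficients of `g`. -/
theorem sum_term {d e : ℕ} (g : ℂ[X]) (c : ℕ → Fin e → ℂ) (z : Fin e → ℂ) (w : ℕ → ℂ)
    (h : ∀ k, w k = ∑ j, c (k + 1) j * z j ^ (k + 1)) (N : ℕ) :
    ∑ j, term d g (fun m => c m j) (z j) (N + 1) = ∑ i ∈ Finset.range d, g.coeff i * w (N + i) := by
  simp only [term]
  rw [Finset.sum_comm]
  refine Finset.sum_congr rfl fun i _ => ?_
  rw [h, Finset.mul_sum]
  refine Finset.sum_congr rfl fun j _ => ?_
  rw [add_right_comm N 1 i, mul_assoc]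

theorem term_const {d : ℕ} (g : ℂ[X]) (hg : g.natDegree < d) (c z : ℂ) (N : ℕ) :
    term d g (fun _ => c) z N = c * g.eval z * z ^ N := by
  rw [eval_eq_sum_range' hg, term, Finset.mul_sum, Finset.sum_mul]
  refine Finset.sum_congr rfl fun i _ => ?_
  rw [pow_add]
  ring

theorem natDegree_f_lt_five (p q r s : ℝ) (hq : q ≠ 0) (hs : s ≠ 0) :
    (f p q r s).natDegree < 5 := by
  rw [f, if_pos ⟨hq, hs⟩]
  compute_degree!

theorem natDegree_f_lt_four (p r s : ℝ) (hs : s ≠ 0) : (f p 0 r s).natDegree < 4 := by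
  rw [f, if_neg (by simp), if_pos ⟨rfl, hs⟩]
  compute_degree!

theorem natDegree_f_lt_two (p q r : ℝ) : (f p q r 0).natDegree < 2 := by
  rw [f, if_neg (by simp), if_neg (by simp)]
  compute_degree!

/-- The polynomial `f` arises from `u (k + 5) + (r - p) * u (k + 4)` by applying the recurrence to
the first summand. -/
theorem det_D_eq_sum_f (p q r s : ℝ) (hq : q ≠ 0) (hs : s ≠ 0) (k : ℕ) :
    (((D p q r s (k + 6)).det : ℝ) : ℂ)
      = ∑ i ∈ Finset.range 5, (f p q r s).coeff i * (u p q r s (k + i) : ℂ) := by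
  obtain ⟨h0, h1, h2, h3, h4⟩ := f_coeff p q r s hq hs
  simp only [Finset.sum_range_succ, Finset.sum_range_zero, h0, h1, h2, h3, h4]
  rw [det_D, u_rec]
  push_cast
  ring_nf

theorem det_D_eq_sum_f_of_q_eq_zero (p r s : ℝ) (hs : s ≠ 0) (k : ℕ) :
    (((D p 0 r s (k + 5)).det : ℝ) : ℂ)
      = ∑ i ∈ Finset.range 4, (f p 0 r s).coeff i * (u p 0 r s (k + i) : ℂ) := by
  obtain ⟨h0, h1, h2, h3⟩ := f_coeff_of_q_eq_zero p r s hs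
  simp only [Finset.sum_range_succ, Finset.sum_range_zero, h0, h1, h2, h3]
  rw [det_D, u_rec_of_q_eq_zero]
  push_cast
  ring_nf

theorem det_D_eq_sum_f_of_s_eq_zero (p q r : ℝ) (k : ℕ) :
    (((D p q r 0 (k + 3)).det : ℝ) : ℂ)
      = ∑ i ∈ Finset.range 2, (f p q r 0).coeff i * (u p q r 0 (k + i) : ℂ) := by
  obtain ⟨h0, h1⟩ := f_coeff_of_s_eq_zero p q r
  simp only [Finset.sum_range_succ, Finset.sum_range_zero, h0, h1]
  rw [det_D, u_rec_of_s_eq_zero]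
  push_cast
  ring_nf

theorem sqrt_sq (z : ℂ) : Complex.sqrt z ^ 2 = z := by
  rw [Complex.sqrt]
  exact_mod_cast Complex.cpow_nat_inv_pow z two_ne_zero

theorem sqrt_ofReal_sq (x : ℝ) (hx : 0 ≤ x) : Complex.sqrt ((x : ℂ) ^ 2) = x := by
  rw [Complex.sqrt, ← Complex.ofReal_pow, show (2⁻¹ : ℂ) = ((2⁻¹ : ℝ) : ℂ) by simp,
    ← Complex.ofReal_cpow (by positivity), ← Real.rpow_natCast, ← Real.rpow_mul hx]
  simp

/-- No condition on the argument of `z` is needed, as the factor is a positive real. -/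
theorem sqrt_four_mul (z : ℂ) : Complex.sqrt (4 * z) = 2 * Complex.sqrt z := by
  rcases eq_or_ne z 0 with rfl | hz
  · simp
  have h := Complex.log_ofReal_mul (show (0 : ℝ) < 4 by norm_num) hz
  have h2 : Complex.sqrt 4 = 2 := by
    have := sqrt_ofReal_sq 2 (by norm_num)
    norm_num at this
    exact this
  rw [← h2, Complex.sqrt, Complex.sqrt, Complex.sqrt, Complex.cpow_def_of_ne_zero (by simp [hz]),
    Complex.cpow_def_of_ne_zero hz, Complex.cpow_def_of_ne_zero (by norm_num), ← Complex.exp_add]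
  rw [Complex.ofReal_log (by norm_num)] at h
  push_cast at h
  rw [h, add_mul]

/-! ### Distinct roots -/

/-- The sequence `w` satisfies the recurrence of `u` and has its first five values, where `Q` stands
for `q ^ 2`. The parameters are complex so that they can be expressed by square roots. -/
structure IsClosedForm (p Q r s : ℂ) (w : ℕ → ℂ) : Prop where
  rec_eq : ∀ k, w (k + 5) = (p - s) * w (k + 4) - (Q - p * s) * w (k + 3)
      + s * (Q - p * s) * w (k + 2) - s ^ 3 * (p - s) * w (k + 1) + s ^ 5 * w k
  zero : w 0 = r
  one : w 1 = p * r - Q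
  two : w 2 = r * (p ^ 2 - Q) - p * Q + 2 * Q * s - p * s ^ 2
  three : w 3 = r * (p ^ 3 - 2 * p * Q + 2 * Q * s - p * s ^ 2)
      + Q ^ 2 - p ^ 2 * Q + 2 * p * Q * s - 2 * Q * s ^ 2 - p ^ 2 * s ^ 2 + s ^ 4
  four : w 4 = r * (p ^ 4 - 3 * p ^ 2 * Q + 4 * p * Q * s + Q ^ 2
        - 2 * Q * s ^ 2 - 2 * p ^ 2 * s ^ 2 + s ^ 4)
      - p ^ 3 * Q + 2 * p ^ 2 * Q * s + 2 * p * Q ^ 2 - 4 * Q ^ 2 * s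
      + 2 * Q * s ^ 3 - p ^ 3 * s ^ 2 + p * s ^ 4

theorem IsClosedForm.u_eq {p q r s : ℝ} {w : ℕ → ℂ} (h : IsClosedForm p ((q : ℂ) ^ 2) r s w)
    (k : ℕ) : (u p q r s k : ℂ) = w k := by
  refine eq_of_recurrence (a := fun k => (u p q r s k : ℂ))
    ![(s : ℂ) ^ 5, -(s ^ 3 * (p - s)), s * (q ^ 2 - p * s), -(q ^ 2 - p * s), p - s]
    (fun k => ?_) (fun k => ?_) (fun i hi => ?_) k
  · simp only [Fin.sum_univ_succ, Fin.sum_univ_zero]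
    rw [u_rec]
    simp
    ring
  · simp only [Fin.sum_univ_succ, Fin.sum_univ_zero]
    rw [h.rec_eq]
    simp
    ring
  · interval_cases i
    · simp [u_zero, h.zero]
    · simp [u_one, h.one]
    · simp [u_two, h.two]
    · rw [u_three, h.three]; push_cast; ring
    · rw [u_four, h.four]; push_cast; ring

/-- For distinct roots the sequence `u` is the sum of the residues of
`(z + s) z ^ 2 (z + r - p) z ^ m / P z`, where `P` is the characteristic polynomial. -/
theorem isClosedForm_of_injective (a a' b b' r s : ℂ) (ha : a * a' = s ^ 2) (hb : b * b' = s ^ 2)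
    (v : Fin 5 → ℂ) (hv : v = ![a, a', b, b', s]) (hinj : Function.Injective v) (p Q : ℂ)
    (hp : p = 2 * s + (a + a') + (b + b')) (hQ : Q = (a + a' + 2 * s) * (b + b' + 2 * s)) :
    IsClosedForm p Q r s fun k => ∑ j, (v j + s) * v j ^ 2 * (v j + r - p)
      / (∏ i ∈ Finset.univ.erase j, (v j - v i)) * v j ^ (k + 1) := by
  -- In terms of `σ` the values of `w` need no denominators: `σ 0 = … = σ 3 = 0`, `σ 4 = 1`, and
  -- the later values come from the recurrence.
  set σ : ℕ → ℂ := fun k => ∑ j, v j ^ k / ∏ i ∈ Finset.univ.erase j, (v j - v i) with hσ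
  have hw : ∀ k, ∑ j, (v j + s) * v j ^ 2 * (v j + r - p)
      / (∏ i ∈ Finset.univ.erase j, (v j - v i)) * v j ^ (k + 1)
      = σ (k + 5) + (s + r - p) * σ (k + 4) + s * (r - p) * σ (k + 3) := by
    intro k
    simp only [hσ, Finset.mul_sum, ← Finset.sum_add_distrib]
    refine Finset.sum_congr rfl fun j _ => ?_
    ring
  have hroot : ∀ j, v j ^ 5 = (p - s) * v j ^ 4 - (Q - p * s) * v j ^ 3
      + s * (Q - p * s) * v j ^ 2 - s ^ 3 * (p - s) * v j + s ^ 5 := by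
    intro j
    suffices h : (v j - s) * (v j ^ 2 - (a + a') * v j + s ^ 2)
        * (v j ^ 2 - (b + b') * v j + s ^ 2) = 0 by
      rw [hp, hQ]
      linear_combination h
    have e1 : a ^ 2 - (a + a') * a + s ^ 2 = 0 := by linear_combination -ha
    have e2 : a' ^ 2 - (a + a') * a' + s ^ 2 = 0 := by linear_combination -ha
    have e3 : b ^ 2 - (b + b') * b + s ^ 2 = 0 := by linear_combination -hb
    have e4 : b' ^ 2 - (b + b') * b' + s ^ 2 = 0 := by linear_combination -hb
    rw [hv]
    fin_cases j <;> simp [e1, e2, e3, e4]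
  have hrec : ∀ k, σ (k + 5) = (p - s) * σ (k + 4) - (Q - p * s) * σ (k + 3)
      + s * (Q - p * s) * σ (k + 2) - s ^ 3 * (p - s) * σ (k + 1) + s ^ 5 * σ k := by
    intro k
    simp only [hσ, Finset.mul_sum, ← Finset.sum_add_distrib, ← Finset.sum_sub_distrib]
    refine Finset.sum_congr rfl fun j _ => ?_
    rw [pow_add, hroot]
    ring
  have h0 : σ 0 = 0 := (sum_pow_div_prod_sub v hinj 0 (by norm_num)).trans (by norm_num)
  have h1 : σ 1 = 0 := (sum_pow_div_prod_sub v hinj 1 (by norm_num)).trans (by norm_num)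
  have h2 : σ 2 = 0 := (sum_pow_div_prod_sub v hinj 2 (by norm_num)).trans (by norm_num)
  have h3 : σ 3 = 0 := (sum_pow_div_prod_sub v hinj 3 (by norm_num)).trans (by norm_num)
  have h4 : σ 4 = 1 := (sum_pow_div_prod_sub v hinj 4 (by norm_num)).trans (by norm_num)
  have h5 := hrec 0
  have h6 := hrec 1
  have h7 := hrec 2
  have h8 := hrec 3
  have h9 := hrec 4
  norm_num only [h0, h1, h2, h3, h4] at h5
  norm_num only [h1, h2, h3, h4, h5] at h6
  norm_num only [h2, h3, h4, h5, h6] at h7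
  norm_num only [h3, h4, h5, h6, h7] at h8
  norm_num only [h4, h5, h6, h7, h8] at h9
  simp only [hw]
  refine ⟨fun k => ?_, ?_, ?_, ?_, ?_, ?_⟩
  · have e1 := hrec (k + 5)
    have e2 := hrec (k + 4)
    have e3 := hrec (k + 3)
    simp only [add_assoc, Nat.reduceAdd] at e1 e2 e3 ⊢
    rw [e1, e2, e3]
    ring
  · norm_num only [h3, h4, h5]; ring
  · norm_num only [h4, h5, h6]; ring
  · norm_num only [h5, h6, h7]; ring
  · norm_num only [h6, h7, h8]; ring
  · norm_num only [h7, h8, h9]; ring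

/-- The coefficient `K` is the residue of `(z + s) z ^ 2 (z + r - p) / P z` at the root `μ`. Here `A`
is the sum of `μ` and the root `s ^ 2 / μ` paired with it, and `B` is the sum of the other pair. -/
theorem K_eq (p q r s x y z μ A B : ℂ) (hμ : μ ≠ 0) (hA : A = μ + s ^ 2 / μ)
    (hp : p = 2 * s + A + B) (hq : q ^ 2 = (A + 2 * s) * (B + 2 * s)) (hx : x = A - B)
    (hz : z = 4 * μ - 2 * A) (hy : y ^ 2 = 4 * (B ^ 2 - 4 * s ^ 2)) :
    K p q r s x y z = (μ + s) * μ ^ 2 * (μ + r - p)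
      / ((2 * μ - A) * (μ ^ 2 - B * μ + s ^ 2) * (μ - s)) := by
  have hden : z * (p - 2 * s + x + z) * (p - 6 * s + x + z) * ((2 * x + z) ^ 2 - y ^ 2)
      = 512 * μ * ((2 * μ - A) * (μ ^ 2 - B * μ + s ^ 2) * (μ - s)) := by
    rw [hy, hp, hx, hz]
    ring
  have hnum : ∀ N : ℂ, N = 8 * μ * ((μ + s) * μ ^ 2 * (μ + r - p)) →
      64 * N / (512 * μ * ((2 * μ - A) * (μ ^ 2 - B * μ + s ^ 2) * (μ - s)))
        = (μ + s) * μ ^ 2 * (μ + r - p)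
          / ((2 * μ - A) * (μ ^ 2 - B * μ + s ^ 2) * (μ - s)) := by
    rintro N rfl
    rw [← mul_div_mul_left ((μ + s) * μ ^ 2 * (μ + r - p)) _ (show 512 * μ ≠ 0 by simpa using hμ)]
    congr 1
    ring
  rw [K, hden]
  apply hnum
  rw [show q ^ 4 = (q ^ 2) ^ 2 by ring, hq, hp, hx, hz, hA]
  field_simp
  ring

/-! ### Multiple roots -/

/-- With `a ^ 2 = p - 6s` and `b ^ 2 = p - 2s` all factors of the denominator of `K₃` split. -/
theorem K₃_eq {a b p r s : ℂ} (ha : a ≠ 0) (hb : b ≠ 0) (hab : b + a ≠ 0)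
    (hs : s = (b ^ 2 - a ^ 2) / 4) (hp : p = (3 * b ^ 2 - a ^ 2) / 2) :
    K₃ p r s (a * b) = (b - a) ^ 2 * (r - p + (b - a) ^ 2 / 4) / (4 * a ^ 4) := by
  have hden : 4 * s * (3 * s - a * b) + p * (p - 8 * s + a * b) = a * b * (b + a) ^ 2 / 2 := by
    rw [hs, hp]; ring
  have h1 : p - 2 * s = b ^ 2 := by rw [hs, hp]; ring
  have h2 : p - 4 * s + a * b = (b + a) ^ 2 / 2 := by rw [hs, hp]; ring
  rw [K₃, hden, h1, h2, hs]
  field_simp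
  ring

/-- If `q ^ 2 = 4s(p - 2s)`, then `s` is a triple root, and the other two roots
`(p - 4s ∓ ab) / 2 = (a ∓ b) ^ 2 / 4` are simple. -/
theorem isClosedForm_triple {a b p r s : ℂ} (ha : a ≠ 0) (hb : b ≠ 0) (hs0 : s ≠ 0)
    (hA : a ^ 2 = p - 6 * s) (hB : b ^ 2 = p - 2 * s) :
    IsClosedForm p (4 * s * (p - 2 * s)) r s fun k =>
      (K₁ p r s + 2 * (k + 1) * K₂ p r s 2 + (k + 1) ^ 2 * K₂ p r s 1) * s ^ (k + 1)
      + K₃ p r s (a * b) * ((p - 4 * s - a * b) / 2) ^ (k + 1)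
      + K₃ p r s (-(a * b)) * ((p - 4 * s + a * b) / 2) ^ (k + 1) := by
  have hs : s = (b ^ 2 - a ^ 2) / 4 := by rw [hA, hB]; ring
  have hp : p = (3 * b ^ 2 - a ^ 2) / 2 := by rw [hA, hB]; ring
  have hplus : b + a ≠ 0 := by
    rintro h
    exact hs0 (by rw [hs]; linear_combination (b - a) / 4 * h)
  have hminus : b + -a ≠ 0 := by
    rintro h
    exact hs0 (by rw [hs]; linear_combination (b + a) / 4 * h)
  -- `c` is the common inverse denominator; multiplying by `4 * a ^ 4 * c = 1` turns the claims about
  -- the first values into polynomial identities.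
  obtain ⟨c, hc⟩ : ∃ c, 4 * a ^ 4 * c = 1 := ⟨_, mul_inv_cancel₀ (by simp [ha])⟩
  have f1 : K₁ p r s = 4 * (p ^ 2 - p * (r + 8 * s) + 2 * s * (2 * r + 11 * s)) * c := by
    rw [K₁, ← hA, div_eq_iff (by simp [ha])]
    linear_combination -(p ^ 2 - p * (r + 8 * s) + 2 * s * (2 * r + 11 * s)) * hc
  have f2 : ∀ j, K₂ p r s j = 4 * (p - r - j * s) * a ^ 2 * c := fun j => by
    rw [K₂, ← hA, div_eq_iff (by simp [ha])]
    linear_combination -(p - r - j * s) * hc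
  have f3 : K₃ p r s (a * b) = (b - a) ^ 2 * (r - p + (b - a) ^ 2 / 4) * c := by
    rw [K₃_eq ha hb hplus hs hp, div_eq_iff (by simp [ha])]
    linear_combination -((b - a) ^ 2 * (r - p + (b - a) ^ 2 / 4)) * hc
  have f4 : K₃ p r s (-(a * b)) = (b + a) ^ 2 * (r - p + (b + a) ^ 2 / 4) * c := by
    rw [← neg_mul, K₃_eq (neg_ne_zero.2 ha) hb hminus (by rw [hs]; ring) (by rw [hp]; ring),
      div_eq_iff (by simp [ha])]
    linear_combination -((b + a) ^ 2 * (r - p + (b + a) ^ 2 / 4)) * hc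
  rw [f1, f2, f2, f3, f4]
  have hz : ∀ z : ℂ, z ^ 2 - (p - 4 * s) * z + s ^ 2 = 0 → ∀ k : ℕ,
      z ^ (k + 5 + 1) = (p - s) * z ^ (k + 4 + 1) - (4 * s * (p - 2 * s) - p * s) * z ^ (k + 3 + 1)
      + s * (4 * s * (p - 2 * s) - p * s) * z ^ (k + 2 + 1) - s ^ 3 * (p - s) * z ^ (k + 1 + 1)
      + s ^ 5 * z ^ (k + 1) := by
    intro z hz k
    linear_combination z ^ (k + 1) * (z - s) ^ 3 * hz
  have hz1 := hz ((p - 4 * s - a * b) / 2) (by rw [hp, hs]; ring)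
  have hz2 := hz ((p - 4 * s + a * b) / 2) (by rw [hp, hs]; ring)
  refine ⟨fun k => ?_, ?_, ?_, ?_, ?_, ?_⟩
  · push_cast
    linear_combination (b - a) ^ 2 * (r - p + (b - a) ^ 2 / 4) * c * hz1 k
      + (b + a) ^ 2 * (r - p + (b + a) ^ 2 / 4) * c * hz2 k
  all_goals
    refine Eq.symm ((mul_one _).symm.trans ((congrArg (_ * ·) hc.symm).trans ?_))
    push_cast
    rw [hp, hs]
    ring

/-- With `a ^ 2 = p - 6s` and `b ^ 2 = p + 2s` all factors of the denominators of `K₅` and `K₄`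
split. -/
theorem K₅_eq {a b p r s : ℂ} (ha : a ≠ 0) (hb : b ≠ 0) (hab : a - b ≠ 0)
    (hs : s = (b ^ 2 - a ^ 2) / 8) (hp : p = (3 * b ^ 2 + a ^ 2) / 4) :
    K₅ p r s (a * b) = -(b - a) ^ 2 * (r - p + (b - a) ^ 2 / 8) / (2 * a ^ 3 * b) := by
  have h1 : p - 6 * s - a * b = a * (a - b) := by rw [hs, hp]; ring
  have h2 : p - 2 * s - a * b = (a - b) ^ 2 / 2 := by rw [hs, hp]; ring
  rw [K₅, h1, h2, hs, hp]
  field_simp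
  ring

theorem K₄_eq {a b p r s : ℂ} (ha : a ≠ 0) (hb : b ≠ 0) (hab : a - b ≠ 0)
    (hs : s = (b ^ 2 - a ^ 2) / 8) (hp : p = (3 * b ^ 2 + a ^ 2) / 4) :
    K₄ p r s (a * b) = -(b - a) ^ 2 * ((r - p + (b - a) ^ 2 / 8) * (a + b)
      + a * (b - a) ^ 2 / 8) / (2 * a ^ 4 * b) := by
  have h0 : p - 6 * s = a ^ 2 := by rw [hs, hp]; ring
  have h1 : p - 6 * s - a * b = a * (a - b) := by rw [hs, hp]; ring
  have h2 : p - 2 * s - a * b = (a - b) ^ 2 / 2 := by rw [hs, hp]; ring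
  rw [K₄, h1, h2, h0, hs, hp]
  field_simp
  ring

/-- If `q ^ 2 = (p + 2s) ^ 2 / 4`, then `(p - 2s ∓ ab) / 4 = (a ∓ b) ^ 2 / 8` are double roots, and
`s` is simple. -/
theorem isClosedForm_double {a b p Q r s : ℂ} (ha : a ≠ 0) (hb : b ≠ 0) (hs0 : s ≠ 0)
    (hA : a ^ 2 = p - 6 * s) (hB : b ^ 2 = p + 2 * s) (hQ : Q = (p + 2 * s) ^ 2 / 4) :
    IsClosedForm p Q r s fun k =>
      (K₄ p r s (a * b) + (k + 1) * K₅ p r s (a * b)) * ((p - 2 * s - a * b) / 4) ^ (k + 1)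
      + (K₄ p r s (-(a * b)) + (k + 1) * K₅ p r s (-(a * b)))
        * ((p - 2 * s + a * b) / 4) ^ (k + 1)
      + 8 * s * (r + s - p) / (p - 6 * s) ^ 2 * s ^ (k + 1) := by
  have hs : s = (b ^ 2 - a ^ 2) / 8 := by rw [hA, hB]; ring
  have hp : p = (3 * b ^ 2 + a ^ 2) / 4 := by rw [hA, hB]; ring
  have hminus : a - b ≠ 0 := by
    rintro h
    exact hs0 (by rw [hs]; linear_combination -(b + a) / 8 * h)
  have hplus : -a - b ≠ 0 := by
    rintro h
    exact hs0 (by rw [hs]; linear_combination -(b - a) / 8 * h)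
  -- `c` is the common inverse denominator, used as for the triple root.
  obtain ⟨c, hc⟩ : ∃ c, 2 * a ^ 4 * b * c = 1 := ⟨_, mul_inv_cancel₀ (by simp [ha, hb])⟩
  have f1 : K₄ p r s (a * b) = -(b - a) ^ 2 * ((r - p + (b - a) ^ 2 / 8) * (a + b)
      + a * (b - a) ^ 2 / 8) * c := by
    rw [K₄_eq ha hb hminus hs hp, eq_comm, eq_div_iff (by simp [ha, hb])]
    linear_combination (-(b - a) ^ 2 * ((r - p + (b - a) ^ 2 / 8) * (a + b)
      + a * (b - a) ^ 2 / 8)) * hc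
  have f2 : K₄ p r s (-(a * b)) = -(b + a) ^ 2 * ((r - p + (b + a) ^ 2 / 8) * (b - a)
      - a * (b + a) ^ 2 / 8) * c := by
    rw [← neg_mul, K₄_eq (neg_ne_zero.2 ha) hb hplus (by rw [hs]; ring) (by rw [hp]; ring),
      eq_comm, eq_div_iff (by simp [ha, hb])]
    linear_combination (-(b + a) ^ 2 * ((r - p + (b + a) ^ 2 / 8) * (b - a)
      - a * (b + a) ^ 2 / 8)) * hc
  have f3 : K₅ p r s (a * b) = -(b - a) ^ 2 * (r - p + (b - a) ^ 2 / 8) * a * c := by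
    rw [K₅_eq ha hb hminus hs hp, eq_comm, eq_div_iff (by simp [ha, hb])]
    linear_combination (-(b - a) ^ 2 * (r - p + (b - a) ^ 2 / 8)) * hc
  have f4 : K₅ p r s (-(a * b)) = (b + a) ^ 2 * (r - p + (b + a) ^ 2 / 8) * a * c := by
    rw [← neg_mul, K₅_eq (neg_ne_zero.2 ha) hb hplus (by rw [hs]; ring) (by rw [hp]; ring),
      eq_comm, eq_div_iff (by simp [ha, hb])]
    linear_combination (-(b + a) ^ 2 * (r - p + (b + a) ^ 2 / 8)) * hc
  have f5 : 8 * s * (r + s - p) / (p - 6 * s) ^ 2 = 16 * s * (r + s - p) * b * c := by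
    rw [← hA, div_eq_iff (by simp [ha])]
    linear_combination -(8 * s * (r + s - p)) * hc
  rw [f1, f2, f3, f4, f5]
  have hQ : Q = b ^ 4 / 4 := by rw [hQ, ← hB]; ring
  have hz : ∀ z : ℂ, z ^ 2 - (p - 2 * s) / 2 * z + s ^ 2 = 0 → ∀ (c d : ℂ) (k : ℕ),
      (c + (k + 5 + 1) * d) * z ^ (k + 5 + 1)
        = (p - s) * ((c + (k + 4 + 1) * d) * z ^ (k + 4 + 1))
        - (Q - p * s) * ((c + (k + 3 + 1) * d) * z ^ (k + 3 + 1))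
        + s * (Q - p * s) * ((c + (k + 2 + 1) * d) * z ^ (k + 2 + 1))
        - s ^ 3 * (p - s) * ((c + (k + 1 + 1) * d) * z ^ (k + 1 + 1))
        + s ^ 5 * ((c + (k + 1) * d) * z ^ (k + 1)) := by
    intro z hz c d k
    -- `z` is a root of the characteristic polynomial `P` and of `P'`: the two summands of the
    -- cofactor come from `P` and `z * P'`.
    rw [hQ, show b ^ 4 = (p + 2 * s) ^ 2 by rw [← hB]; ring]
    linear_combination z ^ (k + 1) * ((c + (k + 1) * d) * (z - s)
      * (z ^ 2 - (p - 2 * s) / 2 * z + s ^ 2) + d * z * ((z ^ 2 - (p - 2 * s) / 2 * z + s ^ 2)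
      + 2 * (z - s) * (2 * z - (p - 2 * s) / 2))) * hz
  have hz1 := hz ((p - 2 * s - a * b) / 4) (by rw [hp, hs]; ring)
  have hz2 := hz ((p - 2 * s + a * b) / 4) (by rw [hp, hs]; ring)
  refine ⟨fun k => ?_, ?_, ?_, ?_, ?_, ?_⟩
  · push_cast
    rw [hz1, hz2]
    generalize (p - 2 * s - a * b) / 4 = z₁
    generalize (p - 2 * s + a * b) / 4 = z₂
    ring
  all_goals
    refine Eq.symm ((mul_one _).symm.trans ((congrArg (_ * ·) hc.symm).trans ?_))
    push_cast
    try rw [hQ]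
    rw [hp, hs]
    ring

/-- If `p = 6s` and `q ^ 2 = 16s ^ 2`, the characteristic polynomial is `(z - s) ^ 5`. -/
theorem isClosedForm_quintuple {r s : ℂ} (hs0 : s ≠ 0) :
    IsClosedForm (6 * s) (16 * s ^ 2) r s fun k =>
      (1 + (k + 1) * ((r + 8 * s) / (6 * s)) + (k + 1) ^ 2 * ((5 * r - 7 * s) / (12 * s))
        + (k + 1) ^ 3 * ((r - 4 * s) / (3 * s)) + (k + 1) ^ 4 * ((r - 5 * s) / (12 * s)))
        * s ^ (k + 1) := by
  refine ⟨fun k => ?_, ?_, ?_, ?_, ?_, ?_⟩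
  · push_cast
    ring
  all_goals
    push_cast
    field_simp
    ring

/-! ### The coefficients `K` for distinct roots -/

theorem injective_vec_five {a b c d e : ℂ} (hab : a ≠ b) (hac : a ≠ c) (had : a ≠ d) (hae : a ≠ e)
    (hbc : b ≠ c) (hbd : b ≠ d) (hbe : b ≠ e) (hcd : c ≠ d) (hce : c ≠ e) (hde : d ≠ e) :
    Function.Injective ![a, b, c, d, e] := by
  intro i j h
  fin_cases i <;> fin_cases j <;> simp_all [eq_comm]

theorem prod_erase_five (g : Fin 5 → ℂ) :
    ∏ i ∈ Finset.univ.erase 0, g i = g 1 * g 2 * g 3 * g 4 ∧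
    ∏ i ∈ Finset.univ.erase 1, g i = g 0 * g 2 * g 3 * g 4 ∧
    ∏ i ∈ Finset.univ.erase 2, g i = g 0 * g 1 * g 3 * g 4 ∧
    ∏ i ∈ Finset.univ.erase 3, g i = g 0 * g 1 * g 2 * g 4 ∧
    ∏ i ∈ Finset.univ.erase 4, g i = g 0 * g 1 * g 2 * g 3 := by
  rw [show Finset.univ.erase (0 : Fin 5) = {1, 2, 3, 4} from by decide,
    show Finset.univ.erase (1 : Fin 5) = {0, 2, 3, 4} from by decide,
    show Finset.univ.erase (2 : Fin 5) = {0, 1, 3, 4} from by decide,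
    show Finset.univ.erase (3 : Fin 5) = {0, 1, 2, 4} from by decide,
    show Finset.univ.erase (4 : Fin 5) = {0, 1, 2, 3} from by decide]
  simp [mul_assoc]

/-- The roots `a, a'` and `b, b'` of `z ^ 2 - A z + s ^ 2` and `z ^ 2 - B z + s ^ 2` and `s` are
distinct, because `(A - 2s)(B - 2s) = q ^ 2 - 4s(p - 2s)`, `(A + 2s)(B + 2s) = q ^ 2` and
`(A - B) ^ 2 = (p + 2s) ^ 2 - 4q ^ 2` do not vanish. -/
theorem isClosedForm_distinct {p q r s α β₁ β₂ : ℂ} (hq : q ≠ 0) (hs : s ≠ 0)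
    (hα : α ^ 2 = (p + 2 * s) ^ 2 - 4 * q ^ 2)
    (hβ₁ : β₁ ^ 2 = 2 * (p - 2 * s) * (p + 2 * s - α) - 4 * q ^ 2)
    (hβ₂ : β₂ ^ 2 = 2 * (p - 2 * s) * (p + 2 * s + α) - 4 * q ^ 2)
    (h1 : q ^ 2 ≠ 4 * s * (p - 2 * s)) (h2 : q ^ 2 ≠ (p + 2 * s) ^ 2 / 4) :
    IsClosedForm p (q ^ 2) r s fun k =>
      K p q r s (-α) β₂ (-β₁) * ((p - 2 * s - α - β₁) / 4) ^ (k + 1)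
      + K p q r s (-α) β₂ β₁ * ((p - 2 * s - α + β₁) / 4) ^ (k + 1)
      + K p q r s α β₁ (-β₂) * ((p - 2 * s + α - β₂) / 4) ^ (k + 1)
      + K p q r s α β₁ β₂ * ((p - 2 * s + α + β₂) / 4) ^ (k + 1)
      + 2 * s * (r + s - p) / (q ^ 2 - 4 * s * (p - 2 * s)) * s ^ (k + 1) := by
  obtain ⟨A, hA⟩ : ∃ A, A = (p - 2 * s - α) / 2 := ⟨_, rfl⟩
  obtain ⟨B, hB⟩ : ∃ B, B = (p - 2 * s + α) / 2 := ⟨_, rfl⟩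
  obtain ⟨a, ha⟩ : ∃ a, a = (p - 2 * s - α - β₁) / 4 := ⟨_, rfl⟩
  obtain ⟨a', ha'⟩ : ∃ a', a' = (p - 2 * s - α + β₁) / 4 := ⟨_, rfl⟩
  obtain ⟨b, hb⟩ : ∃ b, b = (p - 2 * s + α - β₂) / 4 := ⟨_, rfl⟩
  obtain ⟨b', hb'⟩ : ∃ b', b' = (p - 2 * s + α + β₂) / 4 := ⟨_, rfl⟩
  have hp : p = 2 * s + A + B := by rw [hA, hB]; ring
  have hAB : α = B - A := by rw [hA, hB]; ring
  have hq2 : q ^ 2 = (A + 2 * s) * (B + 2 * s) := by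
    rw [hA, hB]; linear_combination hα / 4
  have hβ₁' : β₁ ^ 2 = 4 * (A ^ 2 - 4 * s ^ 2) := by
    rw [hβ₁, hq2, hp, hAB]; ring
  have hβ₂' : β₂ ^ 2 = 4 * (B ^ 2 - 4 * s ^ 2) := by
    rw [hβ₂, hq2, hp, hAB]; ring
  have haA : a + a' = A := by rw [ha, ha', hA]; ring
  have hbB : b + b' = B := by rw [hb, hb', hB]; ring
  have haa : a' - a = β₁ / 2 := by rw [ha, ha']; ring
  have hbb : b' - b = β₂ / 2 := by rw [hb, hb']; ring
  have hap : a * a' = s ^ 2 := by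
    linear_combination (a + a' + A) / 4 * haA - (a' - a + β₁ / 2) / 4 * haa - hβ₁' / 16
  have hbp : b * b' = s ^ 2 := by
    linear_combination (b + b' + B) / 4 * hbB - (b' - b + β₂ / 2) / 4 * hbb - hβ₂' / 16
  have hs2 : s ^ 2 ≠ 0 := pow_ne_zero 2 hs
  have na : a ≠ 0 := left_ne_zero_of_mul (hap ▸ hs2)
  have na' : a' ≠ 0 := right_ne_zero_of_mul (hap ▸ hs2)
  have nb : b ≠ 0 := left_ne_zero_of_mul (hbp ▸ hs2)
  have nb' : b' ≠ 0 := right_ne_zero_of_mul (hbp ▸ hs2)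
  have nprod : (A - 2 * s) * (B - 2 * s) ≠ 0 := fun h => h1 (by
    rw [hq2, hp]; linear_combination h)
  have nA : A - 2 * s ≠ 0 := left_ne_zero_of_mul nprod
  have nB : B - 2 * s ≠ 0 := right_ne_zero_of_mul nprod
  have nA' : A + 2 * s ≠ 0 := left_ne_zero_of_mul (hq2 ▸ pow_ne_zero 2 hq)
  have nB' : B + 2 * s ≠ 0 := right_ne_zero_of_mul (hq2 ▸ pow_ne_zero 2 hq)
  have nAB : A - B ≠ 0 := fun h => h2 (by
    rw [hq2, hp]; linear_combination -(A - B) / 4 * h)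
  have eqa : ∀ z, z = a ∨ z = a' → z ^ 2 - A * z + s ^ 2 = 0 := by
    rintro z (rfl | rfl) <;> rw [← haA] <;> linear_combination -hap
  have eqb : ∀ z, z = b ∨ z = b' → z ^ 2 - B * z + s ^ 2 = 0 := by
    rintro z (rfl | rfl) <;> rw [← hbB] <;> linear_combination -hbp
  have ncross : ∀ y z, y = a ∨ y = a' → z = b ∨ z = b' → y ≠ z := by
    rintro y _ hy hz rfl
    have hy0 : y ≠ 0 := by rcases hy with rfl | rfl <;> assumption
    exact mul_ne_zero nAB hy0 (by linear_combination eqb y hz - eqa y hy)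
  have nsa : ∀ y, y = a ∨ y = a' → y ≠ s := by
    rintro _ hy rfl
    exact mul_ne_zero nA hs (by linear_combination -eqa _ hy)
  have nsb : ∀ y, y = b ∨ y = b' → y ≠ s := by
    rintro _ hy rfl
    exact mul_ne_zero nB hs (by linear_combination -eqb _ hy)
  have naa : a ≠ a' := by
    intro h
    refine mul_ne_zero nA nA' ?_
    rw [← haA]
    linear_combination (a - a') * h + 4 * hap
  have nbb : b ≠ b' := by
    intro h
    refine mul_ne_zero nB nB' ?_
    rw [← hbB]
    linear_combination (b - b') * h + 4 * hbp
  have hinj : Function.Injective ![a, a', b, b', s] := injective_vec_five naa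
    (ncross _ _ (.inl rfl) (.inl rfl)) (ncross _ _ (.inl rfl) (.inr rfl)) (nsa _ (.inl rfl))
    (ncross _ _ (.inr rfl) (.inl rfl)) (ncross _ _ (.inr rfl) (.inr rfl)) (nsa _ (.inr rfl))
    nbb (nsb _ (.inl rfl)) (nsb _ (.inr rfl))
  have key := isClosedForm_of_injective a a' b b' r s hap hbp _ rfl hinj p (q ^ 2)
    (by rw [hp, haA, hbB]) (by rw [hq2, haA, hbB])
  have sum_of : ∀ {x y z : ℂ}, y ≠ 0 → y ^ 2 - x * y + z ^ 2 = 0 → x = y + z ^ 2 / y := by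
    intro x y z hy h
    field_simp
    linear_combination -h
  have k1 := K_eq p q r s (-α) β₂ (-β₁) a A B na (sum_of na (eqa a (.inl rfl))) hp hq2
    (by rw [hAB]; ring) (by linear_combination 2 * haa - 2 * haA) hβ₂'
  have k2 := K_eq p q r s (-α) β₂ β₁ a' A B na' (sum_of na' (eqa a' (.inr rfl))) hp hq2
    (by rw [hAB]; ring) (by linear_combination -2 * haa - 2 * haA) hβ₂'
  have k3 := K_eq p q r s α β₁ (-β₂) b B A nb (sum_of nb (eqb b (.inl rfl)))
    (by rw [hp]; ring) (by rw [hq2]; ring)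
    (by rw [hAB]) (by linear_combination 2 * hbb - 2 * hbB) hβ₁'
  have k4 := K_eq p q r s α β₁ β₂ b' B A nb' (sum_of nb' (eqb b' (.inr rfl)))
    (by rw [hp]; ring) (by rw [hq2]; ring)
    (by rw [hAB]) (by linear_combination -2 * hbb - 2 * hbB) hβ₁'
  have k5 : 2 * s * (r + s - p) / (q ^ 2 - 4 * s * (p - 2 * s))
      = (s + s) * s ^ 2 * (s + r - p) / ((s - a) * (s - a') * (s - b) * (s - b')) := by
    have e : (s - a) * (s - a') * (s - b) * (s - b')
        = s ^ 2 * (q ^ 2 - 4 * s * (p - 2 * s)) := by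
      rw [show (s - a) * (s - a') * (s - b) * (s - b')
        = (s ^ 2 - (a + a') * s + a * a') * (s ^ 2 - (b + b') * s + b * b') by ring,
        hap, hbp, haA, hbB, hq2, hp]
      ring
    rw [e, ← mul_div_mul_left _ _ hs2]
    ring_nf
  convert key using 2 with k
  simp only [Fin.sum_univ_five, prod_erase_five, ← ha, ← ha', ← hb, ← hb', k1, k2, k3, k4, k5,
    Matrix.cons_val]
  congr 1
  congr 1
  congr 1
  congr 1
  all_goals
    congr 2
    simp only [← haA, ← hbB]
  · linear_combination (2 * a - (a + a')) * (a - s) * (-hbp)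
  · linear_combination (2 * a' - (a + a')) * (a' - s) * (-hbp)
  · linear_combination (2 * b - (b + b')) * (b - s) * (-hap)
  · linear_combination (2 * b' - (b + b')) * (b' - s) * (-hap)

/-! ### Closed forms of `u` with the principal square roots -/

/-- A given square root `z` of `x * y` is the product of a square root of `x` and one of `y`. -/
theorem exists_sq_eq_sq_eq {x y z : ℂ} (hz : z ^ 2 = x * y) (hx : x ≠ 0) :
    ∃ a b, a ^ 2 = x ∧ b ^ 2 = y ∧ z = a * b := by
  have ha : Complex.sqrt x ≠ 0 := fun h => hx (by rw [← sqrt_sq x, h]; ring)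
  refine ⟨Complex.sqrt x, z / Complex.sqrt x, sqrt_sq x, ?_, by field_simp⟩
  rw [div_pow, hz, sqrt_sq]
  field_simp

/-- `isClosedForm_triple` with the principal root `γ` in place of `a * b`. -/
theorem isClosedForm_of_triple {p r s : ℝ} (hs : s ≠ 0) (h6 : p ≠ 6 * s) (h2 : p ≠ 2 * s) :
    IsClosedForm p (4 * s * (p - 2 * s)) r s fun k =>
      (K₁ p r s + 2 * (k + 1) * K₂ p r s 2 + (k + 1) ^ 2 * K₂ p r s 1) * s ^ (k + 1)
      + K₃ p r s (γ p s) * ((p - 4 * s - γ p s) / 2) ^ (k + 1)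
      + K₃ p r s (-γ p s) * ((p - 4 * s + γ p s) / 2) ^ (k + 1) := by
  have h6' : (p : ℂ) - 6 * s ≠ 0 := by exact_mod_cast sub_ne_zero.2 h6
  have h2' : (p : ℂ) - 2 * s ≠ 0 := by exact_mod_cast sub_ne_zero.2 h2
  obtain ⟨a, b, ha, hb, hab⟩ := exists_sq_eq_sq_eq (sqrt_sq (((p : ℂ) - 6 * s) * (p - 2 * s))) h6'
  have hγ : γ p s = a * b := hab
  rw [hγ]
  exact isClosedForm_triple (by rintro rfl; exact h6' (by rw [← ha]; ring))
    (by rintro rfl; exact h2' (by rw [← hb]; ring)) (by exact_mod_cast hs) ha hb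

theorem u_eq_sum (p q r s : ℝ) (hq : q ≠ 0) (hs : s ≠ 0) (k : ℕ) :
    (u p q r s k : ℂ) = ∑ j, κ p q r s (k + 1) j * μ p q s j ^ (k + 1) := by
  have hs' : (s : ℂ) ≠ 0 := by exact_mod_cast hs
  rw [Fin.sum_univ_five]
  by_cases h1 : q ^ 2 = 4 * s * (p - 2 * s)
  · have hp2 : p ≠ 2 * s := by
      rintro rfl
      exact hq (by simpa using h1)
    have h1' : (q : ℂ) ^ 2 = 4 * s * (p - 2 * s) := by exact_mod_cast h1
    have hα : α p q s = Complex.sqrt (((p : ℂ) - 6 * s) ^ 2) := by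
      rw [α, h1']
      ring_nf
    -- The sign of `p - 6s` decides whether `s` is `μ₁ = μ₂` or `μ₃ = μ₄`.
    rcases lt_trichotomy p (6 * s) with h6 | h6 | h6
    · have hα : α p q s = 6 * s - p := by
        rw [hα, show ((p : ℂ) - 6 * s) ^ 2 = ((6 * s - p : ℝ) : ℂ) ^ 2 by push_cast; ring,
          sqrt_ofReal_sq _ (by linarith)]
        push_cast
        ring
      have hβ₁ : β₁ p q s = 2 * γ p s := by
        rw [β₁, γ, ← sqrt_four_mul, hα, h1']
        ring_nf
      have hβ₂ : β₂ p q s = 0 := by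
        rw [β₂, hα, h1', ← Complex.sqrt_zero]
        ring_nf
      rw [κ, if_neg (fun h => h.1 h1), if_neg (fun h => h6.not_gt h.2), if_pos ⟨h1, h6⟩,
        IsClosedForm.u_eq (h1' ▸ isClosedForm_of_triple (r := r) hs h6.ne hp2)]
      simp only [μ, hα, hβ₁, hβ₂, Matrix.cons_val]
      push_cast
      ring_nf
    · subst h6
      have h1'' : (q : ℂ) ^ 2 = 16 * s ^ 2 := by rw [h1']; push_cast; ring
      have hα : α (6 * s) q s = 0 := by
        rw [hα, ← Complex.sqrt_zero]
        push_cast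
        ring_nf
      have hβ₁ : β₁ (6 * s) q s = 0 := by
        rw [β₁, hα, h1']
        refine (congrArg Complex.sqrt ?_).trans Complex.sqrt_zero
        push_cast
        ring
      have hβ₂ : β₂ (6 * s) q s = 0 := by
        rw [β₂, hα, h1']
        refine (congrArg Complex.sqrt ?_).trans Complex.sqrt_zero
        push_cast
        ring
      have hF := isClosedForm_quintuple (r := (r : ℂ)) hs'
      rw [← h1'', show (6 : ℂ) * s = ((6 * s : ℝ) : ℂ) by push_cast; rfl] at hF
      rw [κ, if_neg (fun h => h.1 h1), if_neg (fun h => lt_irrefl _ h.2),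
        if_neg (fun h => lt_irrefl _ h.2), if_neg (fun h => h.2 rfl), hF.u_eq]
      simp only [μ, hα, hβ₁, hβ₂, Matrix.cons_val]
      push_cast
      ring_nf
    · have hα : α p q s = p - 6 * s := by
        rw [hα, show ((p : ℂ) - 6 * s) ^ 2 = ((p - 6 * s : ℝ) : ℂ) ^ 2 by push_cast; ring,
          sqrt_ofReal_sq _ (by linarith)]
        push_cast
        ring
      have hβ₁ : β₁ p q s = 0 := by
        rw [β₁, hα, h1', ← Complex.sqrt_zero]
        ring_nf
      have hβ₂ : β₂ p q s = 2 * γ p s := by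
        rw [β₂, γ, ← sqrt_four_mul, hα, h1']
        ring_nf
      rw [κ, if_neg (fun h => h.1 h1), if_pos ⟨h1, h6⟩,
        IsClosedForm.u_eq (h1' ▸ isClosedForm_of_triple (r := r) hs h6.ne' hp2)]
      simp only [μ, hα, hβ₁, hβ₂, Matrix.cons_val]
      push_cast
      ring_nf
  · have h1' : (q : ℂ) ^ 2 ≠ 4 * s * (p - 2 * s) := by exact_mod_cast h1
    by_cases h2 : q ^ 2 = (p + 2 * s) ^ 2 / 4
    · have h2' : (q : ℂ) ^ 2 = (p + 2 * s) ^ 2 / 4 := by exact_mod_cast h2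
      have h6 : p ≠ 6 * s := by
        rintro rfl
        exact h1 (by rw [h2]; ring)
      have h6' : (p : ℂ) - 6 * s ≠ 0 := by exact_mod_cast sub_ne_zero.2 h6
      obtain ⟨a, b, ha, hb, hab⟩ :=
        exists_sq_eq_sq_eq (sqrt_sq (((p : ℂ) - 6 * s) * (p + 2 * s))) h6'
      have hδ : δ p s = a * b := hab
      have hα : α p q s = 0 := by
        rw [α, h2', ← Complex.sqrt_zero]
        ring_nf
      have hβ₁ : β₁ p q s = δ p s := by
        rw [β₁, δ, hα, h2']
        ring_nf
      have hβ₂ : β₂ p q s = δ p s := by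
        rw [β₂, δ, hα, h2']
        ring_nf
      have hb0 : b ≠ 0 := by
        rintro rfl
        have h : (q : ℂ) ^ 2 = 0 := by
          rw [h2', ← hb]
          ring
        exact hq (by simpa using h)
      have ha0 : a ≠ 0 := by
        rintro rfl
        exact h6' (by rw [← ha]; ring)
      rw [κ, if_neg (fun h => h.2 h2), if_neg (fun h => h1 h.1), if_neg (fun h => h1 h.1),
        if_pos ⟨h2, h6⟩, (isClosedForm_double ha0 hb0 hs' ha hb h2').u_eq]
      simp only [μ, hα, hβ₁, hβ₂, hδ, Matrix.cons_val]
      push_cast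
      ring_nf
    · have h2' : (q : ℂ) ^ 2 ≠ (p + 2 * s) ^ 2 / 4 := by exact_mod_cast h2
      have hF := isClosedForm_distinct (p := p) (r := r) (α := α p q s) (β₁ := β₁ p q s)
        (β₂ := β₂ p q s) (by exact_mod_cast hq) hs' (sqrt_sq _) (sqrt_sq _) (sqrt_sq _) h1' h2'
      rw [κ, if_pos ⟨h1, h2⟩, hF.u_eq]
      simp only [μ, Matrix.cons_val]

theorem u_eq_sum_of_q_eq_zero (p r s : ℝ) (hs : s ≠ 0) (k : ℕ) :
    (u p 0 r s k : ℂ) = ∑ j, κ' p r s (k + 1) j * ν p s j ^ (k + 1) := by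
  have hs' : (s : ℂ) ≠ 0 := by exact_mod_cast hs
  have h0 : (u p 0 r s 0 : ℂ) = r := by simp [u_zero]
  have h1 : (u p 0 r s 1 : ℂ) = p * r := by simp [u_one]
  have h2 : (u p 0 r s 2 : ℂ) = r * p ^ 2 - p * s ^ 2 := by simp [u_two]
  have h3 : (u p 0 r s 3 : ℂ) = r * (p ^ 3 - p * s ^ 2) - p ^ 2 * s ^ 2 + s ^ 4 := by
    simp [u_three]
  have hrec : ∀ w : ℕ → ℂ, (∀ k, w (k + 4) = p * w (k + 3) - p * s ^ 2 * w (k + 1)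
      + s ^ 4 * w k) → ∀ k, w (k + 4) =
        ∑ i, ![(s : ℂ) ^ 4, -(p * s ^ 2), 0, (p : ℂ)] i * w (k + i) := by
    intro w hw k
    rw [hw]
    simp [Fin.sum_univ_four]
    ring
  have hu : ∀ k, (u p 0 r s (k + 4) : ℂ) = p * u p 0 r s (k + 3) - p * s ^ 2 * u p 0 r s (k + 1)
      + s ^ 4 * u p 0 r s k := by
    intro k
    rw [u_rec_of_q_eq_zero]
    push_cast
    ring
  suffices h : ∃ w : ℕ → ℂ, (∀ k, ∑ j, κ' p r s (k + 1) j * ν p s j ^ (k + 1) = w k) ∧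
      (∀ k, w (k + 4) = p * w (k + 3) - p * s ^ 2 * w (k + 1) + s ^ 4 * w k) ∧
      w 0 = r ∧ w 1 = p * r ∧ w 2 = r * p ^ 2 - p * s ^ 2 ∧
      w 3 = r * (p ^ 3 - p * s ^ 2) - p ^ 2 * s ^ 2 + s ^ 4 by
    obtain ⟨w, hw, hr, w0, w1, w2, w3⟩ := h
    rw [hw]
    refine eq_of_recurrence (a := fun k => (u p 0 r s k : ℂ)) _
      (hrec (fun k => (u p 0 r s k : ℂ)) hu) (hrec _ hr)
      (fun i hi => ?_) k
    interval_cases i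
    · exact h0.trans w0.symm
    · exact h1.trans w1.symm
    · exact h2.trans w2.symm
    · exact h3.trans w3.symm
  by_cases hps : p ^ 2 = 4 * s ^ 2
  · have hω : Complex.sqrt ((p : ℂ) ^ 2 - 4 * s ^ 2) = 0 := by
      refine (congrArg Complex.sqrt ?_).trans Complex.sqrt_zero
      rw [sub_eq_zero]
      exact_mod_cast hps
    simp only [κ', if_neg (not_not.2 hps), Fin.sum_univ_four, ν, hω]
    have hcases : p = 2 * s ∨ p = -(2 * s) := by
      apply sq_eq_sq_iff_eq_or_eq_neg.1
      rw [hps]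
      ring
    rcases hcases with rfl | rfl
    · simp only [if_true, Matrix.cons_val]
      push_cast
      refine ⟨_, fun k => rfl, fun k => ?_, ?_, ?_, ?_, ?_⟩
      · have e : (2 * (s : ℂ) - 0) / 2 = s := by ring
        have e' : (2 * (s : ℂ) + 0) / 2 = s := by ring
        simp only [e, e']
        push_cast
        ring
      all_goals
        push_cast
        field_simp
        ring
    · have hne : -(2 * s) ≠ 2 * s := fun h => hs (by linarith)
      simp only [if_neg hne, Matrix.cons_val]
      push_cast
      refine ⟨_, fun k => rfl, fun k => ?_, ?_, ?_, ?_, ?_⟩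
      · have e : (-(2 * (s : ℂ)) - 0) / 2 = -s := by ring
        have e' : (-(2 * (s : ℂ)) + 0) / 2 = -s := by ring
        simp only [e, e']
        push_cast
        ring
      all_goals
        push_cast
        field_simp
        ring
  · simp only [κ', if_pos hps, Fin.sum_univ_four, ν, K₆, K₇, Matrix.cons_val]
    obtain ⟨ω, hω⟩ : ∃ ω, ω = Complex.sqrt ((p : ℂ) ^ 2 - 4 * s ^ 2) := ⟨_, rfl⟩
    rw [← hω]
    have hω2 : ω ^ 2 = (p : ℂ) ^ 2 - 4 * s ^ 2 := by rw [hω]; exact sqrt_sq _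
    have hprod : (s : ℂ) ^ 2 = (p - ω) / 2 * ((p + ω) / 2) := by linear_combination hω2 / 4
    have hps' : (p : ℂ) ^ 2 - 4 * s ^ 2 ≠ 0 := by exact_mod_cast sub_ne_zero.2 hps
    -- `ν₃ = a ^ 2`, `ν₄ = b ^ 2` and `s = a * b` make all denominators split.
    obtain ⟨a, b, ha, hb, hsab⟩ := exists_sq_eq_sq_eq hprod
      (left_ne_zero_of_mul (hprod ▸ pow_ne_zero 2 hs'))
    have hpab : (p : ℂ) = a ^ 2 + b ^ 2 := by rw [ha, hb]; ring
    have hωab : ω = b ^ 2 - a ^ 2 := by rw [ha, hb]; ring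
    have hfac : (p : ℂ) ^ 2 - 4 * s ^ 2 = (b + a) ^ 2 * (b - a) ^ 2 := by rw [hpab, hsab]; ring
    rw [hfac] at hps'
    have hplus : b + a ≠ 0 := fun h => left_ne_zero_of_mul hps' (by rw [h]; ring)
    have hminus : b - a ≠ 0 := fun h => right_ne_zero_of_mul hps' (by rw [h]; ring)
    have ha0 : a ≠ 0 := by rintro rfl; exact hs' (by rw [hsab]; ring)
    have hb0 : b ≠ 0 := by rintro rfl; exact hs' (by rw [hsab]; ring)
    have d1 : 2 * ((p : ℂ) + 2 * 1 * s) = 2 * (b + a) ^ 2 := by rw [hpab, hsab]; ring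
    have d2 : 2 * ((p : ℂ) + 2 * -1 * s) = 2 * (b - a) ^ 2 := by rw [hpab, hsab]; ring
    have d3 : (p : ℂ) ^ 2 - 2 * s ^ 2 - 1 * p * ω = 2 * a ^ 4 := by rw [hpab, hsab, hωab]; ring
    have d4 : (p : ℂ) ^ 2 - 2 * s ^ 2 - -1 * p * ω = 2 * b ^ 4 := by rw [hpab, hsab, hωab]; ring
    rw [hfac, d1, d2, d3, d4, ← ha, ← hb]
    refine ⟨_, fun k => rfl, fun k => ?_, ?_, ?_, ?_, ?_⟩
    · generalize ((p : ℂ) - r + 1 * s) / (2 * (b + a) ^ 2) = c₁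
      generalize ((p : ℂ) - r + -1 * s) / (2 * (b - a) ^ 2) = c₂
      generalize _ / ((b + a) ^ 2 * (b - a) ^ 2 * (2 * a ^ 4)) = c₃
      generalize _ / ((b + a) ^ 2 * (b - a) ^ 2 * (2 * b ^ 4)) = c₄
      rw [hpab, hsab]
      ring
    all_goals
      rw [hpab, hsab, hωab]
      field_simp
      ring

theorem u_eq_sum_of_s_eq_zero (p q r : ℝ) (hq : q ≠ 0) (k : ℕ) :
    (u p q r 0 k : ℂ) = ∑ j, κ'' p q r (k + 1) j * ξ p q j ^ (k + 1) := by
  have hq' : (q : ℂ) ≠ 0 := by exact_mod_cast hq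
  have h0 : (u p q r 0 0 : ℂ) = r := by simp [u_zero]
  have h1 : (u p q r 0 1 : ℂ) = p * r - q ^ 2 := by simp [u_one]
  have hrec : ∀ w : ℕ → ℂ, (∀ k, w (k + 2) = p * w (k + 1) - q ^ 2 * w k) → ∀ k, w (k + 2) =
        ∑ i, ![-(q : ℂ) ^ 2, (p : ℂ)] i * w (k + i) := by
    intro w hw k
    rw [hw]
    simp [Fin.sum_univ_two]
    ring
  have hu : ∀ k, (u p q r 0 (k + 2) : ℂ) = p * u p q r 0 (k + 1) - q ^ 2 * u p q r 0 k := by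
    intro k
    rw [u_rec_of_s_eq_zero]
    push_cast
    ring
  suffices h : ∃ w : ℕ → ℂ, (∀ k, ∑ j, κ'' p q r (k + 1) j * ξ p q j ^ (k + 1) = w k) ∧
      (∀ k, w (k + 2) = p * w (k + 1) - q ^ 2 * w k) ∧ w 0 = r ∧ w 1 = p * r - q ^ 2 by
    obtain ⟨w, hw, hr, w0, w1⟩ := h
    rw [hw]
    refine eq_of_recurrence (a := fun k => (u p q r 0 k : ℂ)) _
      (hrec (fun k => (u p q r 0 k : ℂ)) hu) (hrec _ hr)
      (fun i hi => ?_) k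
    interval_cases i
    · exact h0.trans w0.symm
    · exact h1.trans w1.symm
  simp only [κ'', Fin.sum_univ_two, ξ]
  set θ := Complex.sqrt ((p : ℂ) ^ 2 - 4 * q ^ 2) with hθ
  have hθ2 : θ ^ 2 = (p : ℂ) ^ 2 - 4 * q ^ 2 := sqrt_sq _
  have hq2 : (q : ℂ) ^ 2 = (p ^ 2 - θ ^ 2) / 4 := by rw [hθ2]; ring
  by_cases hpq : p ^ 2 = 4 * q ^ 2
  · have hpq' : (p : ℂ) ^ 2 = 4 * q ^ 2 := by exact_mod_cast hpq
    have hθ0 : θ = 0 := by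
      rw [← pow_eq_zero_iff two_ne_zero, hθ2, hpq', sub_self]
    have hp : (p : ℂ) ≠ 0 := by
      intro h
      rw [h] at hpq'
      exact hq' (by simpa using hpq'.symm)
    simp only [if_neg (not_not.2 hpq), Matrix.cons_val, hq2, hθ0]
    refine ⟨_, fun k => rfl, fun k => ?_, ?_, ?_⟩
    · rw [sub_zero, add_zero]
      push_cast
      field_simp
      ring
    all_goals
      push_cast
      field_simp
      ring
  · have hpq' : (p : ℂ) ^ 2 ≠ 4 * q ^ 2 := by exact_mod_cast hpq
    have hθ0 : θ ≠ 0 := by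
      intro h
      exact hpq' (by rw [← sub_eq_zero, ← hθ2, h]; ring)
    simp only [if_pos hpq, Matrix.cons_val, hq2]
    refine ⟨_, fun k => rfl, fun k => ?_, ?_, ?_⟩
    · ring
    all_goals
      field_simp
      ring

theorem u_of_q_eq_zero_of_s_eq_zero (p r : ℝ) (k : ℕ) : u p 0 r 0 k = r * p ^ k := by
  induction k with
  | zero => simp [u_zero]
  | succ k ih =>
    rcases k with _ | k
    · rw [u_one]
      ring
    · rw [u_rec_of_s_eq_zero, ih]
      ring

end Penta

theorem theorem3p1 (p q r s : ℝ) (n : ℕ) :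
    (q ≠ 0 → s ≠ 0 → 6 ≤ n →
      (((Penta.D p q r s n).det : ℝ) : ℂ)
          = ∑ j : Fin 5, Penta.term 5 (Penta.f p q r s) (fun m => Penta.κ p q r s m j)
              (Penta.μ p q s j) (n - 5) ∧
      (q ^ 2 ≠ 4 * s * (p - 2 * s) → q ^ 2 ≠ (p + 2 * s) ^ 2 / 4 →
        (((Penta.D p q r s n).det : ℝ) : ℂ)
          = ∑ j : Fin 5, Penta.κ p q r s n j * (Penta.f p q r s).eval (Penta.μ p q s j)
              * Penta.μ p q s j ^ (n - 5))) ∧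
    (q = 0 → s ≠ 0 → 5 ≤ n →
      (((Penta.D p q r s n).det : ℝ) : ℂ)
          = ∑ j : Fin 4, Penta.term 4 (Penta.f p q r s) (fun m => Penta.κ' p r s m j)
              (Penta.ν p s j) (n - 4) ∧
      (p ^ 2 ≠ 4 * s ^ 2 →
        (((Penta.D p q r s n).det : ℝ) : ℂ)
          = ∑ j : Fin 4, Penta.κ' p r s n j * (Penta.f p q r s).eval (Penta.ν p s j)
              * Penta.ν p s j ^ (n - 4))) ∧
    (q ≠ 0 → s = 0 → 3 ≤ n →
      (((Penta.D p q r s n).det : ℝ) : ℂ)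
          = ∑ j : Fin 2, Penta.term 2 (Penta.f p q r s) (fun m => Penta.κ'' p q r m j)
              (Penta.ξ p q j) (n - 2) ∧
      (p ^ 2 ≠ 4 * q ^ 2 →
        (((Penta.D p q r s n).det : ℝ) : ℂ)
          = ∑ j : Fin 2, Penta.κ'' p q r n j * (Penta.f p q r s).eval (Penta.ξ p q j)
              * Penta.ξ p q j ^ (n - 2))) ∧
    (q = 0 → s = 0 → 3 ≤ n →
      (Penta.D p q r s n).det = r ^ 2 * p ^ (n - 2)) := by
  refine ⟨fun hq hs hn => ?_, ?_, ?_, ?_⟩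
  · obtain ⟨k, rfl⟩ := Nat.exists_eq_add_of_le' hn
    have key : (((Penta.D p q r s (k + 6)).det : ℝ) : ℂ)
        = ∑ j : Fin 5, Penta.term 5 (Penta.f p q r s) (fun m => Penta.κ p q r s m j)
            (Penta.μ p q s j) (k + 1) := by
      rw [Penta.sum_term _ _ _ _ (Penta.u_eq_sum p q r s hq hs), Penta.det_D_eq_sum_f _ _ _ _ hq hs]
    refine ⟨key, fun h1 h2 => key.trans (Finset.sum_congr rfl fun j _ => ?_)⟩
    have hκ : ∀ m, Penta.κ p q r s m j = Penta.κ p q r s (k + 6) j := fun m => by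
      simp only [Penta.κ, if_pos (And.intro h1 h2)]
    simp only [hκ]
    exact Penta.term_const _ (Penta.natDegree_f_lt_five p q r s hq hs) _ _ _
  · rintro rfl hs hn
    obtain ⟨k, rfl⟩ := Nat.exists_eq_add_of_le' hn
    have key : (((Penta.D p 0 r s (k + 5)).det : ℝ) : ℂ)
        = ∑ j : Fin 4, Penta.term 4 (Penta.f p 0 r s) (fun m => Penta.κ' p r s m j)
            (Penta.ν p s j) (k + 1) := by
      rw [Penta.sum_term _ _ _ _ (Penta.u_eq_sum_of_q_eq_zero p r s hs),
        Penta.det_D_eq_sum_f_of_q_eq_zero _ _ _ hs]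
    refine ⟨key, fun h => key.trans (Finset.sum_congr rfl fun j _ => ?_)⟩
    have hκ : ∀ m, Penta.κ' p r s m j = Penta.κ' p r s (k + 5) j := fun m => by
      simp only [Penta.κ', if_pos h]
    simp only [hκ]
    exact Penta.term_const _ (Penta.natDegree_f_lt_four p r s hs) _ _ _
  · rintro hq rfl hn
    obtain ⟨k, rfl⟩ := Nat.exists_eq_add_of_le' hn
    have key : (((Penta.D p q r 0 (k + 3)).det : ℝ) : ℂ)
        = ∑ j : Fin 2, Penta.term 2 (Penta.f p q r 0) (fun m => Penta.κ'' p q r m j)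
            (Penta.ξ p q j) (k + 1) := by
      rw [Penta.sum_term _ _ _ _ (Penta.u_eq_sum_of_s_eq_zero p q r hq),
        Penta.det_D_eq_sum_f_of_s_eq_zero]
    refine ⟨key, fun h => key.trans (Finset.sum_congr rfl fun j _ => ?_)⟩
    have hκ : ∀ m, Penta.κ'' p q r m j = Penta.κ'' p q r (k + 3) j := fun m => by
      simp only [Penta.κ'', if_pos h]
    simp only [hκ]
    exact Penta.term_const _ (Penta.natDegree_f_lt_two p q r) _ _ _
  · rintro rfl rfl hn
    obtain ⟨k, rfl⟩ := Nat.exists_eq_add_of_le' hn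
    rw [Penta.det_D, Penta.u_of_q_eq_zero_of_s_eq_zero, Penta.u_of_q_eq_zero_of_s_eq_zero,
      show k + 3 - 2 = k + 1 from rfl]
    ring
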